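/- Work in $\mathsf{RCA}_0$ (second-order arithmetic with the basic axioms, $\Sigma^0_1$-induction and $\Delta^0_1$-comprehension); equivalently, by the completeness theorem, the following holds in every model $(M,\mathcal S)$ of $\mathsf{RCA}_0$, standard or not, when all notions are interpreted in $(M,\mathcal S)$. Let $Q$ be a quasi order, given as a set $Q\subseteq\mathbb N$ with a binary relation $\leq_Q$ that is reflexive and transitive. For infinite $X\subseteq\mathbb N$ let $X^-$ be $X$ without its least element. $Q$ is called $\Delta^0_2$-$\mathsf{BQO}$ if for any function $F:[\mathbb N]^\omega\to Q$ on the infinite sets of natural numbers whose graph $F(X)=q$ is defined by a $\Sigma^0_2$-formula, possibly with number and set parameters, there is an $X\in[\mathbb N]^\omega$ with $F(X)\leq_Q F(X^-)$. A barrier is a set $B$ of (codes of) finite subsets of $\mathbb N$ such that $\bigcup B$ is infinite, every infinite set $X\subseteq\bigcup B$ has an initial segment in $B$, and no element of $B$ is a proper subset of another. For finite sets $s,t$ write $s\vartriangleleft t$ if there is an infinite set $X$ such that $s$ is an initial segment of $X$ and $t$ is an initial segment of $X^-$. A quasi order $P$ is called $\mathsf{BQO}$ if for any barrier $B$ and any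 function $f:B\to P$ there are $s,t\in B$ with $s\vartriangleleft t$ and $f(s)\leq_P f(t)$. Let $T_f(Q)$ be the set of (codes of) finite ordered trees with labels from $Q$, generated by the clause that $q\star\langle b_0,\ldots,b_{n-1}\rangle\in T_f(Q)$ whenever $q\in Q$ and $b_0,\ldots,b_{n-1}\in T_f(Q)$ (possibly $n=0$). For $a=p\star\langle a_0,\ldots,a_{m-1}\rangle$ and $b=q\star\langle b_0,\ldots,b_{n-1}\rangle$ define recursively $$a\leq^w b\quad\Leftrightarrow\quad\bigl(p\leq_Q q\text{ and }a_i\leq^w b\text{ for all }i<m\bigr)\ \text{ or }\ a\leq^w b_j\text{ for some }j<n .$$ **Theorem ($\mathsf{RCA}_0$).** If $Q$ is $\Delta^0_2$-$\mathsf{BQO}$, then the set $T_f(Q)$ and the relation $\leq^w$ exist, and $T_f^w(Q)=(T_f(Q),\leq^w)$ is a quasi order that is $\mathsf{BQO}$. -/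

import Mathlib

/-!
Second-order arithmetic is interpreted in two-sorted (Henkin) structures: the first-order part is
a type `M` with `0, 1, +, *, <`, possibly nonstandard, and the second-order part is a collection
`S` of subsets of `M`. By the completeness theorem, a statement is provable in `RCA₀` if and only
if it holds in all structures `(M, S)` that satisfy the axioms of `RCA₀`.
-/

namespace SOA

/-! ### Bounded formulas of the language of second-order arithmetic -/

/-- Numerical terms. Number variables are de Bruijn indices. -/
inductive Tm : Type
  | var (i : ℕ) : Tm
  | zero : Tm
  | one : Tm
  | add (t u : Tm) : Tm
  | mul (t u : Tm) : Tm

/-- `Σ⁰₀` formulas: the only quantifiers are bounded number quantifiers, and set variables occur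
free only. The bounded quantifier `ball t φ` binds the number variable `0` of `φ` and stands for
`∀ x < t, φ`. The missing connectives and `∃ x < t` are definable. -/
inductive BFm : Type
  | eq (t u : Tm) : BFm
  | lt (t u : Tm) : BFm
  | mem (t : Tm) (X : ℕ) : BFm
  | neg (φ : BFm) : BFm
  | and (φ ψ : BFm) : BFm
  | ball (t : Tm) (φ : BFm) : BFm

/-- Put `x` in front of an assignment of variables. -/
def cons {α : Type*} (x : α) (v : ℕ → α) : ℕ → α
  | 0 => x
  | n + 1 => v n

section Structure

variable {M : Type*} [Zero M] [One M] [Add M] [Mul M] [LT M]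

/-- Value of a term under an assignment of the number variables. -/
def Tm.eval (v : ℕ → M) : Tm → M
  | .var i => v i
  | .zero => 0
  | .one => 1
  | .add t u => t.eval v + u.eval v
  | .mul t u => t.eval v * u.eval v

/-- Truth of a `Σ⁰₀` formula under assignments of the number variables and set variables. -/
def BFm.eval (A : ℕ → Set M) : BFm → (ℕ → M) → Prop
  | .eq t u, v => t.eval v = u.eval v
  | .lt t u, v => t.eval v < u.eval v
  | .mem t X, v => t.eval v ∈ A X
  | .neg φ, v => ¬ φ.eval A v
  | .and φ ψ, v => φ.eval A v ∧ ψ.eval A v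
  | .ball t φ, v => ∀ x : M, x < t.eval v → φ.eval A (cons x v)

/-! ### The axioms of `RCA₀` -/

/-- `(M, S)` is a model of `RCA₀`: the basic axioms, induction for `Σ⁰₁` formulas and
comprehension for `Δ⁰₁` formulas, where number parameters (`v`) and set parameters (`A`)
are allowed. -/
structure IsModelRCA0 (S : Set (Set M)) : Prop where
  sets_nonempty : S.Nonempty
  succ_ne_zero : ∀ n : M, n + 1 ≠ 0
  succ_inj : ∀ m n : M, m + 1 = n + 1 → m = n
  add_zero : ∀ m : M, m + 0 = m
  add_succ : ∀ m n : M, m + (n + 1) = (m + n) + 1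
  mul_zero : ∀ m : M, m * 0 = 0
  mul_succ : ∀ m n : M, m * (n + 1) = m * n + m
  not_lt_zero : ∀ m : M, ¬ m < 0
  lt_succ : ∀ m n : M, m < n + 1 ↔ (m < n ∨ m = n)
  sigma_one_induction : ∀ (θ : BFm) (v : ℕ → M) (A : ℕ → Set M), (∀ i, A i ∈ S) →
    (∃ k, θ.eval A (cons k (cons 0 v))) →
    (∀ n, (∃ k, θ.eval A (cons k (cons n v))) → ∃ k, θ.eval A (cons k (cons (n + 1) v))) →
    ∀ n, ∃ k, θ.eval A (cons k (cons n v))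
  delta_one_comprehension : ∀ (θ η : BFm) (v : ℕ → M) (A : ℕ → Set M), (∀ i, A i ∈ S) →
    (∀ n, (∃ k, θ.eval A (cons k (cons n v))) ↔ ∀ k, η.eval A (cons k (cons n v))) →
    {n | ∃ k, θ.eval A (cons k (cons n v))} ∈ S

/-! ### Codes of pairs, finite sets and finite sequences -/

/-- The pairing function `(m + n)² + m`. -/
def pair (m n : M) : M := (m + n) * (m + n) + m

/-- `i` is an element of the finite set represented by `k = ((p, m), n)`, namely of
`{i < p | m * (i + 1) + 1 divides n}`. -/
def Elem (i k : M) : Prop :=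
  ∃ p m n : M, k = pair (pair p m) n ∧ i < p ∧ ∃ c : M, n = (m * (i + 1) + 1) * c

/-- The finite set represented by the number `k`. -/
def finSet (k : M) : Set M := {i | Elem i k}

/-- `k` is the code of a finite set: the least number that represents this set. These codes
are the elements of `[ℕ]^{<ω}`. -/
def IsFinSetCode (k : M) : Prop := ∀ k' : M, k' < k → finSet k' ≠ finSet k

/-- `s` is the code of a finite sequence of length `l`, identified with its graph. -/
def IsSeqOfLength (s l : M) : Prop :=
  IsFinSetCode s ∧ (∀ e ∈ finSet s, ∃ i j : M, i < l ∧ e = pair i j) ∧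
    ∀ i : M, i < l → ∃! j : M, pair i j ∈ finSet s

/-- `s` is the code of a finite sequence. -/
def IsSeq (s : M) : Prop := ∃ l : M, IsSeqOfLength s l

/-- `b` is an entry of the finite sequence with code `s`. -/
def IsEntry (b s : M) : Prop := ∃ i : M, pair i b ∈ finSet s

/-! ### Infinite sets, initial segments, barriers -/

/-- `X` is infinite in the sense of the structure. -/
def Unbounded (X : Set M) : Prop := ∀ n : M, ∃ m ∈ X, n < m

/-- `X⁻`, the set `X` without its least element. -/
def tail (X : Set M) : Set M := {x ∈ X | ∃ y ∈ X, y < x}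

/-- The set `s` is an initial segment of the set `X`. -/
def InitSeg (s X : Set M) : Prop := s ⊆ X ∧ ∀ y ∈ s, ∀ x ∈ X, x < y → x ∈ s

/-- The relation `s ◁ t` between codes of finite sets: for some infinite `X`, the set `s` is an
initial segment of `X` and `t` is an initial segment of `X⁻`. -/
def Tri (S : Set (Set M)) (s t : M) : Prop :=
  ∃ X ∈ S, Unbounded X ∧ InitSeg (finSet s) X ∧ InitSeg (finSet t) (tail X)

/-- The base of a family of finite sets, i.e. its union. -/
def base (B : Set M) : Set M := {n | ∃ s ∈ B, n ∈ finSet s}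

/-- `B ∈ S` is a barrier. -/
structure IsBarrier (S : Set (Set M)) (B : Set M) : Prop where
  mem_sets : B ∈ S
  codes : ∀ s ∈ B, IsFinSetCode s
  base_infinite : Unbounded (base B)
  exists_initSeg : ∀ X ∈ S, Unbounded X → X ⊆ base B → ∃ s ∈ B, InitSeg (finSet s) X
  antichain : ∀ s ∈ B, ∀ t ∈ B, finSet s ⊆ finSet t → s = t

/-! ### Quasi orders, `BQO` and `Δ⁰₂-BQO` -/

/-- `R` is (the set of pairs of) a quasi order on the set `Q`, where both sets belong to `S`. -/
structure IsQuasiOrder (S : Set (Set M)) (Q R : Set M) : Prop where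
  field_mem : Q ∈ S
  rel_mem : R ∈ S
  rel_subset : ∀ z ∈ R, ∃ p ∈ Q, ∃ q ∈ Q, z = pair p q
  refl : ∀ q ∈ Q, pair q q ∈ R
  trans : ∀ p ∈ Q, ∀ q ∈ Q, ∀ r ∈ Q, pair p q ∈ R → pair q r ∈ R → pair p r ∈ R

/-- `f ∈ S` is (the graph of) a function from `B` to `Q`. -/
structure IsFunction (S : Set (Set M)) (f B Q : Set M) : Prop where
  mem_sets : f ∈ S
  subset : ∀ z ∈ f, ∃ s ∈ B, ∃ q ∈ Q, z = pair s q
  existsUnique : ∀ s ∈ B, ∃! q : M, pair s q ∈ f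

/-- The quasi order `(Q, R)` is `BQO` in the structure `(M, S)`: for every array `f : B → Q` on a
barrier `B` there are `s ◁ t` in `B` with `f(s) ≤ f(t)`. -/
def IsBQO (S : Set (Set M)) (Q R : Set M) : Prop :=
  IsQuasiOrder S Q R ∧
    ∀ B f : Set M, IsBarrier S B → IsFunction S f B Q →
      ∃ s ∈ B, ∃ t ∈ B, Tri S s t ∧ ∃ p q : M, pair s p ∈ f ∧ pair t q ∈ f ∧ pair p q ∈ R

/-- The relation between a set `X` and a number `q` that is defined by the `Σ⁰₂` formula
`∃ m ∀ n θ` with number parameters `v` and set parameters `A`. -/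
def SigmaTwoRel (θ : BFm) (v : ℕ → M) (A : ℕ → Set M) (X : Set M) (q : M) : Prop :=
  ∃ m : M, ∀ n : M, θ.eval (cons X A) (cons n (cons m (cons q v)))

/-- The quasi order `(Q, R)` is `Δ⁰₂-BQO` in the structure `(M, S)`: whenever a `Σ⁰₂` formula with
parameters defines the graph of a function `F` from the infinite sets in `S` to `Q`, there is an
infinite `X ∈ S` with `F(X) ≤ F(X⁻)`. -/
def IsDeltaTwoBQO (S : Set (Set M)) (Q R : Set M) : Prop :=
  IsQuasiOrder S Q R ∧
    ∀ (θ : BFm) (v : ℕ → M) (A : ℕ → Set M), (∀ i, A i ∈ S) →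
      (∀ X ∈ S, Unbounded X →
        (∃! q : M, SigmaTwoRel θ v A X q) ∧ ∀ q : M, SigmaTwoRel θ v A X q → q ∈ Q) →
      ∃ X ∈ S, Unbounded X ∧
        ∃ p q : M, SigmaTwoRel θ v A X p ∧ SigmaTwoRel θ v A (tail X) q ∧ pair p q ∈ R

/-! ### Finite labelled trees and the weak homomorphism order -/

/-- `T` satisfies the recursive clause for the set `T_f(Q)` of finite ordered trees with labels
from `Q`, where `q ⋆ ⟨b₀, …, bₙ₋₁⟩` is coded by the pair of `q` and the sequence
`⟨b₀, …, bₙ₋₁⟩`. As the entries of a sequence have smaller codes than the tree, this determines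
`T ∈ S` uniquely in any model of `RCA₀`. -/
def IsTreeSet (Q T : Set M) : Prop :=
  ∀ x : M, x ∈ T ↔ ∃ q ∈ Q, ∃ s : M, x = pair q s ∧ IsSeq s ∧ ∀ b : M, IsEntry b s → b ∈ T

/-- `L` satisfies the recursive clause for (the set of pairs of) the relation `≤ʷ` on the set `T`
of trees with labels from the quasi order with relation `R`:
`p ⋆ s ≤ʷ q ⋆ t` if and only if `p ≤ q` and `a ≤ʷ q ⋆ t` for all entries `a` of `s`, or
`p ⋆ s ≤ʷ b` for some entry `b` of `t`. -/
def IsWeakOrder (R T L : Set M) : Prop :=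
  (∀ z ∈ L, ∃ x ∈ T, ∃ y ∈ T, z = pair x y) ∧
    ∀ p s q t : M, pair p s ∈ T → pair q t ∈ T →
      (pair (pair p s) (pair q t) ∈ L ↔
        (pair p q ∈ R ∧ ∀ a : M, IsEntry a s → pair a (pair q t) ∈ L) ∨
          ∃ b : M, IsEntry b t ∧ pair (pair p s) b ∈ L)

end Structure

end SOA

/-! Suppose `f : B → T` is an array of trees on a barrier with no `s ◁ t` such that `f(s) ≤ʷ f(t)`.
It induces a function on infinite sets `X`. Dropping the first `k` elements of `X` gives trees `F X
k` with `F X k ≰ F X (k + 1)`, and passing from `X` to `X⁻` shifts this sequence by one place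
(`exists_values_of_array`).

A bad pair `u ≰ v` can be made smaller. If the label of `u` is below the label of `v`, then some
immediate subtree of `u` is not below `v`, since otherwise `u ≤ʷ v`; replace `u` by the first such
subtree. Otherwise keep `u`. Doing this at all places of the sequence at once preserves badness: the
new `u` is still not below `v`, and the new `v` is `v` itself or an immediate subtree of it, so
nothing that fails to lie below `v` lies below the new `v` (`treeStep_cases`, `not_mem_treeStep`).
The replacement is recursive and looks only at neighbouring places, so it can be iterated and
commutes with the shift (`IsIteration.invariant`, `IsIteration.shift`).

At a fixed place the codes never increase during the iteration. The least code that is attained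
exists by `Σ⁰₁` induction, so the tree is eventually constant (`exists_eventually_const`). There
need be no recursive bound on the stage of stabilization, but the label of the limit at place `0` is
a `Σ⁰₂`-definable function of `X`. If `Q` is `Δ⁰₂-BQO`, then for some `X` the limit label for `X` is
below the one for `X⁻`, which is the limit label at place `1` for `X`. At a late stage the tree at
place `0` would then have to be replaced by a proper subtree, although it no longer changes.

To run this inside any model, arithmetic is derived from the axioms, definability of predicates is
organized in contexts and left to instance resolution, finite sets are coded by divisibility
(`exists_code`), and course-of-values recursion follows. Recursion on codes also yields the set of
trees and the weak order. -/

namespace SOA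

set_option linter.unusedSectionVars false

/-! ### Renaming of variables -/

/-- Rename the variables of a term along `ρ`. -/
def Tm.ren (ρ : ℕ → ℕ) : Tm → Tm
  | .var i => .var (ρ i)
  | .zero => .zero
  | .one => .one
  | .add t u => .add (t.ren ρ) (u.ren ρ)
  | .mul t u => .mul (t.ren ρ) (u.ren ρ)

/-- The extension of a renaming to the scope of a quantifier. -/
def liftRen (ρ : ℕ → ℕ) : ℕ → ℕ
  | 0 => 0
  | i + 1 => ρ i + 1

/-- Rename number variables along `ρ` and set variables along `σ`. -/
def BFm.ren (ρ σ : ℕ → ℕ) : BFm → BFm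
  | .eq t u => .eq (t.ren ρ) (u.ren ρ)
  | .lt t u => .lt (t.ren ρ) (u.ren ρ)
  | .mem t X => .mem (t.ren ρ) (σ X)
  | .neg φ => .neg (φ.ren ρ σ)
  | .and φ ψ => .and (φ.ren ρ σ) (ψ.ren ρ σ)
  | .ball t φ => .ball (t.ren ρ) (φ.ren (liftRen ρ) σ)

/-- The sequence that interleaves `v` and `w`. -/
def interleave {α : Type*} (v w : ℕ → α) (i : ℕ) : α := if i % 2 = 0 then v (i / 2) else w (i / 2)

@[simp] theorem interleave_even {α : Type*} (v w : ℕ → α) (i : ℕ) :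
    interleave v w (2 * i) = v i := by simp [interleave]

@[simp] theorem interleave_odd {α : Type*} (v w : ℕ → α) (i : ℕ) :
    interleave v w (2 * i + 1) = w i := by
  have h : (2 * i + 1) / 2 = i := by omega
  simp [interleave, h]

section Raw

variable {M : Type*} [Zero M] [One M] [Add M] [Mul M] [LT M]

theorem Tm.eval_ren (ρ : ℕ → ℕ) (v : ℕ → M) (t : Tm) :
    (t.ren ρ).eval v = t.eval (fun i => v (ρ i)) := by
  induction t <;> simp_all [Tm.ren, Tm.eval]

theorem cons_liftRen (ρ : ℕ → ℕ) (x : M) (v : ℕ → M) :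
    (fun i => cons x v (liftRen ρ i)) = cons x (fun i => v (ρ i)) := by
  funext i; cases i <;> rfl

theorem BFm.eval_ren (A : ℕ → Set M) (φ : BFm) (ρ σ : ℕ → ℕ) (v : ℕ → M) :
    (φ.ren ρ σ).eval A v ↔ φ.eval (fun i => A (σ i)) (fun i => v (ρ i)) := by
  induction φ generalizing ρ v with
  | eq t u => simp [BFm.ren, BFm.eval, Tm.eval_ren]
  | lt t u => simp [BFm.ren, BFm.eval, Tm.eval_ren]
  | mem t X => simp [BFm.ren, BFm.eval, Tm.eval_ren]
  | neg φ ih => simp [BFm.ren, BFm.eval, ih]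
  | and φ ψ ih ih' => simp [BFm.ren, BFm.eval, ih, ih']
  | ball t φ ih => simp [BFm.ren, BFm.eval, ih, Tm.eval_ren, cons_liftRen]

/-! ### Contexts -/

/-- A context consists of one set variable and finitely many number variables. The assignment
`env γ v` lists the values of the latter at `γ`, followed by the parameters `v`. -/
class Ctx (S : Set (Set M)) (Γ : Type*) where
  param : Γ → Set M
  param_mem : ∀ γ, param γ ∈ S
  depth : ℕ
  env : Γ → (ℕ → M) → ℕ → M
  env_lt : ∀ γ v w i, i < depth → env γ v i = env γ w i
  env_add : ∀ γ v i, env γ v (i + depth) = v i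

/-- The property `p` need not be definable: it only restricts the sets at which formulas are
evaluated. -/
instance Ctx.subtype (S : Set (Set M)) (p : Set M → Prop) :
    Ctx S {X : Set M // X ∈ S ∧ p X} where
  param X := X.1
  param_mem X := X.2.1
  depth := 0
  env _ v := v
  env_lt _ _ _ _ h := absurd h (Nat.not_lt_zero _)
  env_add _ _ _ := rfl

instance Ctx.prod (S : Set (Set M)) (Γ : Type*) [Ctx S Γ] : Ctx S (Γ × M) where
  param p := Ctx.param S p.1
  param_mem p := Ctx.param_mem p.1
  depth := Ctx.depth S Γ + 1
  env p v := cons p.2 (Ctx.env S p.1 v)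
  env_lt p v w i h := by
    cases i with
    | zero => rfl
    | succ i => exact Ctx.env_lt p.1 v w i (Nat.lt_of_succ_lt_succ h)
  env_add p v i := Ctx.env_add p.1 v i

variable (S : Set (Set M)) {Γ Δ : Type*} [Ctx S Γ] [Ctx S Δ]

/-- The function `f` is given by a term with parameters. -/
def IsTm (f : Γ → M) : Prop := ∃ (t : Tm) (v : ℕ → M), ∀ γ, f γ = t.eval (Ctx.env S γ v)

/-- The predicate `P` is defined by a `Σ⁰₀` formula with number parameters and set parameters
from `S`. -/
def IsD0 (P : Γ → Prop) : Prop :=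
  ∃ (φ : BFm) (v : ℕ → M) (A : ℕ → Set M), (∀ i, A i ∈ S) ∧
    ∀ γ, P γ ↔ φ.eval (cons (Ctx.param S γ) A) (Ctx.env S γ v)

/-- The map `g` between contexts permutes, duplicates or forgets variables. -/
def IsRen (g : Γ → Δ) : Prop :=
  (∀ γ, Ctx.param S (g γ) = Ctx.param S γ) ∧
    ∃ ρ : ℕ → ℕ, ∀ γ v i, Ctx.env S (g γ) v i = Ctx.env S γ v (ρ i)

variable {S}

theorem isRen_id : IsRen S (fun γ : Γ => γ) := ⟨fun _ => rfl, id, fun _ _ _ => rfl⟩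

theorem IsRen.weak {g : Γ → Δ} (hg : IsRen S g) : IsRen S (fun p : Γ × M => g p.1) := by
  obtain ⟨h, ρ, hρ⟩ := hg
  exact ⟨fun p => h p.1, fun i => ρ i + 1, fun p v i => hρ p.1 v i⟩

theorem isRen_fst : IsRen S (fun p : Γ × M => p.1) := isRen_id.weak

theorem IsRen.lift {g : Γ → Δ} (hg : IsRen S g) : IsRen S (fun p : Γ × M => (g p.1, p.2)) := by
  obtain ⟨h, ρ, hρ⟩ := hg
  refine ⟨fun p => h p.1, liftRen ρ, fun p v i => ?_⟩
  cases i with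
  | zero => rfl
  | succ i => exact hρ p.1 v i

variable (S Γ) in
-- Two formulas come with separate parameters, so a connective needs a common assignment.
-- Interleaving the parameters provides one; indices below the depth of the context stay fixed.
theorem exists_merge (v w : ℕ → M) : ∃ (u : ℕ → M) (ρ σ : ℕ → ℕ), ∀ γ : Γ,
    (∀ i, Ctx.env S γ u (ρ i) = Ctx.env S γ v i) ∧
      ∀ i, Ctx.env S γ u (σ i) = Ctx.env S γ w i := by
  let d := Ctx.depth S Γ
  have key : ∀ (u v : ℕ → M) (τ : ℕ → ℕ), (∀ i, u (τ i) = v i) → ∀ (γ : Γ) (i : ℕ),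
      Ctx.env S γ u (if i < d then i else τ (i - d) + d) = Ctx.env S γ v i := by
    intro u v τ h γ i
    split_ifs with hi
    · exact Ctx.env_lt γ u v i hi
    · rw [Ctx.env_add, h, ← Ctx.env_add (S := S) γ v, Nat.sub_add_cancel (not_lt.mp hi)]
  exact ⟨interleave v w, _, _, fun γ =>
    ⟨key _ v (fun i => 2 * i) (by simp) γ, key _ w (fun i => 2 * i + 1) (by simp) γ⟩⟩

/-! ### Terms -/

theorem isTm_const (a : M) : IsTm S (fun _ : Γ => a) :=
  ⟨.var (0 + Ctx.depth S Γ), fun _ => a, fun γ => (Ctx.env_add (S := S) γ (fun _ => a) 0).symm⟩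

theorem IsTm.comp {f : Δ → M} (hf : IsTm S f) {g : Γ → Δ} (hg : IsRen S g) :
    IsTm S (fun γ => f (g γ)) := by
  obtain ⟨t, v, h⟩ := hf
  obtain ⟨-, ρ, hρ⟩ := hg
  refine ⟨t.ren ρ, v, fun γ => ?_⟩
  simp only [h, Tm.eval_ren]
  congr 1
  funext i
  exact hρ γ v i

theorem IsTm.merge {f g : Γ → M} (hf : IsTm S f) (hg : IsTm S g) :
    ∃ (t u : Tm) (v : ℕ → M),
      ∀ γ, f γ = t.eval (Ctx.env S γ v) ∧ g γ = u.eval (Ctx.env S γ v) := by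
  obtain ⟨t, v, h⟩ := hf
  obtain ⟨u, w, h'⟩ := hg
  obtain ⟨x, ρ, σ, hx⟩ := exists_merge S Γ v w
  exact ⟨t.ren ρ, u.ren σ, x, fun γ => by simp [Tm.eval_ren, hx γ, h, h']⟩

theorem IsTm.add {f g : Γ → M} (hf : IsTm S f) (hg : IsTm S g) : IsTm S (fun γ => f γ + g γ) := by
  obtain ⟨t, u, v, h⟩ := hf.merge hg
  exact ⟨t.add u, v, fun γ => by simp only [(h γ).1, (h γ).2]; rfl⟩

theorem IsTm.mul {f g : Γ → M} (hf : IsTm S f) (hg : IsTm S g) : IsTm S (fun γ => f γ * g γ) := by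
  obtain ⟨t, u, v, h⟩ := hf.merge hg
  exact ⟨t.mul u, v, fun γ => by simp only [(h γ).1, (h γ).2]; rfl⟩

theorem isTm_var : IsTm S (fun p : Γ × M => p.2) := ⟨.var 0, fun _ => 0, fun _ => rfl⟩

theorem IsTm.weak {f : Γ → M} (hf : IsTm S f) : IsTm S (fun p : Γ × M => f p.1) :=
  hf.comp isRen_fst

/-! ### `Σ⁰₀` predicates -/

theorem IsD0.congr {P P' : Γ → Prop} (hP : IsD0 S P) (h : ∀ γ, P' γ ↔ P γ) : IsD0 S P' := by
  obtain ⟨φ, v, A, hA, hφ⟩ := hP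
  exact ⟨φ, v, A, hA, fun γ => (h γ).trans (hφ γ)⟩

theorem IsD0.comp {P : Δ → Prop} (hP : IsD0 S P) {g : Γ → Δ} (hg : IsRen S g) :
    IsD0 S (fun γ => P (g γ)) := by
  obtain ⟨φ, v, A, hA, hφ⟩ := hP
  obtain ⟨hp, ρ, hρ⟩ := hg
  refine ⟨φ.ren ρ id, v, A, hA, fun γ => ?_⟩
  change P (g γ) ↔ _
  rw [hφ, BFm.eval_ren, hp]
  have : (fun i => Ctx.env S γ v (ρ i)) = Ctx.env S (g γ) v := funext fun i => (hρ γ v i).symm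
  rw [this]
  rfl

theorem IsD0.not {P : Γ → Prop} (hP : IsD0 S P) : IsD0 S (fun γ => ¬ P γ) := by
  obtain ⟨φ, v, A, hA, hφ⟩ := hP
  exact ⟨φ.neg, v, A, hA, fun γ => not_congr (hφ γ)⟩

theorem cons_interleave (X : Set M) (A B : ℕ → Set M) :
    (fun i => cons X (interleave A B) (Nat.casesOn i 0 fun j => 2 * j + 1)) = cons X A ∧
      (fun i => cons X (interleave A B) (Nat.casesOn i 0 fun j => 2 * j + 1 + 1)) = cons X B := by
  constructor <;> funext i <;> cases i <;> simp [cons]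

theorem IsD0.merge {P P' : Γ → Prop} (hP : IsD0 S P) (hP' : IsD0 S P') :
    ∃ (φ ψ : BFm) (v : ℕ → M) (A : ℕ → Set M), (∀ i, A i ∈ S) ∧
      ∀ γ, (P γ ↔ φ.eval (cons (Ctx.param S γ) A) (Ctx.env S γ v)) ∧
        (P' γ ↔ ψ.eval (cons (Ctx.param S γ) A) (Ctx.env S γ v)) := by
  obtain ⟨φ, v, A, hA, hφ⟩ := hP
  obtain ⟨ψ, w, B, hB, hψ⟩ := hP'
  obtain ⟨x, ρ, σ, hx⟩ := exists_merge S Γ v w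
  refine ⟨φ.ren ρ (fun i => Nat.casesOn i 0 fun j => 2 * j + 1),
    ψ.ren σ (fun i => Nat.casesOn i 0 fun j => 2 * j + 1 + 1), x, interleave A B, ?_, fun γ => ?_⟩
  · intro i
    unfold interleave
    split_ifs
    exacts [hA _, hB _]
  · simp only [BFm.eval_ren, (cons_interleave _ A B).1, (cons_interleave _ A B).2,
      hx γ, hφ, hψ, and_self]

theorem IsD0.and {P P' : Γ → Prop} (hP : IsD0 S P) (hP' : IsD0 S P') :
    IsD0 S (fun γ => P γ ∧ P' γ) := by
  obtain ⟨φ, ψ, v, A, hA, h⟩ := hP.merge hP'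
  exact ⟨φ.and ψ, v, A, hA, fun γ => and_congr (h γ).1 (h γ).2⟩

theorem IsD0.or {P P' : Γ → Prop} (hP : IsD0 S P) (hP' : IsD0 S P') :
    IsD0 S (fun γ => P γ ∨ P' γ) :=
  (hP.not.and hP'.not).not.congr fun γ => by tauto

theorem IsD0.ball {P : Γ × M → Prop} (hP : IsD0 S P) {b : Γ → M} (hb : IsTm S b) :
    IsD0 S (fun γ => ∀ x < b γ, P (γ, x)) := by
  obtain ⟨t, w, ht⟩ := hb
  obtain ⟨φ, v, A, hA, hφ⟩ := hP
  obtain ⟨u, ρ, σ, hu⟩ := exists_merge S Γ v w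
  refine ⟨.ball (t.ren σ) (φ.ren (liftRen ρ) id), u, A, hA, fun γ => ?_⟩
  simp only [BFm.eval, Tm.eval_ren, BFm.eval_ren, (hu γ).2, ← ht, hφ, cons_liftRen, (hu γ).1]
  rfl

theorem IsD0.bex {P : Γ × M → Prop} (hP : IsD0 S P) {b : Γ → M} (hb : IsTm S b) :
    IsD0 S (fun γ => ∃ x < b γ, P (γ, x)) :=
  (hP.not.ball hb).not.congr fun γ => by push Not; rfl

theorem isD0_mem {U : Set M} (hU : U ∈ S) {f : Γ → M} (hf : IsTm S f) :
    IsD0 S (fun γ => f γ ∈ U) := by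
  obtain ⟨t, v, ht⟩ := hf
  -- Set index `0` is reserved for the set variable of the context.
  exact ⟨.mem t 1, v, fun _ => U, fun _ => hU, fun γ => by simp [BFm.eval, cons, ht]⟩

variable (hne : S.Nonempty)
include hne

theorem isD0_mem_param {f : Γ → M} (hf : IsTm S f) : IsD0 S (fun γ => f γ ∈ Ctx.param S γ) := by
  obtain ⟨t, v, ht⟩ := hf
  exact ⟨.mem t 0, v, fun _ => hne.some, fun _ => hne.some_mem, fun γ => by simp [BFm.eval, cons, ht]⟩

theorem isD0_eq {f g : Γ → M} (hf : IsTm S f) (hg : IsTm S g) : IsD0 S (fun γ => f γ = g γ) := by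
  obtain ⟨t, u, v, h⟩ := hf.merge hg
  exact ⟨.eq t u, v, fun _ => hne.some, fun _ => hne.some_mem, fun γ => by
    simp only [(h γ).1, (h γ).2]; rfl⟩

theorem isD0_lt {f g : Γ → M} (hf : IsTm S f) (hg : IsTm S g) : IsD0 S (fun γ => f γ < g γ) := by
  obtain ⟨t, u, v, h⟩ := hf.merge hg
  exact ⟨.lt t u, v, fun _ => hne.some, fun _ => hne.some_mem, fun γ => by
    simp only [(h γ).1, (h γ).2]; rfl⟩

end Raw

/-! ### Models of `RCA₀` are ordered semirings -/

section RawModel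

variable {M : Type*} [Zero M] [One M] [Add M] [Mul M] [LT M] {S : Set (Set M)}

/-- The context that consists of an arbitrary set variable. -/
abbrev Base (S : Set (Set M)) : Type _ := {X : Set M // X ∈ S ∧ True}

namespace IsModelRCA0

variable (hS : IsModelRCA0 S)
include hS

theorem induction_isD0 {P : M → Prop} (hP : IsD0 S (fun p : Base S × M => P p.2)) (h0 : P 0)
    (hs : ∀ n, P n → P (n + 1)) (n : M) : P n := by
  obtain ⟨φ, v, A, hA, h⟩ := hP
  obtain ⟨X, hX⟩ := hS.sets_nonempty
  -- The existential witness in the induction axiom is a dummy here; the renaming skips it.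
  have key : ∀ k n : M, (φ.ren (fun i => i + 1) id).eval (cons X A) (cons k (cons n v)) ↔ P n :=
    fun k n => (BFm.eval_ren _ _ _ _ _).trans (h (⟨X, hX, trivial⟩, n)).symm
  have hXA : ∀ i, cons X A i ∈ S := fun i => by
    cases i
    exacts [hX, hA _]
  obtain ⟨k, hk⟩ := hS.sigma_one_induction _ v _ hXA ⟨0, (key 0 0).2 h0⟩
    (fun n ⟨k, hk⟩ => ⟨k, (key k _).2 (hs n ((key k n).1 hk))⟩) n
  exact (key k n).1 hk

theorem zero_add' (a : M) : 0 + a = a := by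
  have hne := hS.sets_nonempty
  refine hS.induction_isD0 (P := fun n => 0 + n = n) ?_ (hS.add_zero 0) (fun n ih => ?_) a
  · apply_rules [isD0_eq, IsTm.add, isTm_var, isTm_const]
  · rw [hS.add_succ, ih]

theorem add_assoc' (a b c : M) : a + b + c = a + (b + c) := by
  have hne := hS.sets_nonempty
  refine hS.induction_isD0 (P := fun n => a + b + n = a + (b + n)) ?_ ?_ (fun n ih => ?_) c
  · apply_rules [isD0_eq, IsTm.add, isTm_var, isTm_const]
  · rw [hS.add_zero, hS.add_zero]
  · rw [hS.add_succ, ih, hS.add_succ, hS.add_succ]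

theorem succ_add' (a b : M) : a + 1 + b = a + b + 1 := by
  have hne := hS.sets_nonempty
  refine hS.induction_isD0 (P := fun n => a + 1 + n = a + n + 1) ?_ ?_ (fun n ih => ?_) b
  · apply_rules [isD0_eq, IsTm.add, isTm_var, isTm_const]
  · rw [hS.add_zero, hS.add_zero]
  · rw [hS.add_succ, ih, hS.add_succ]

theorem add_comm' (a b : M) : a + b = b + a := by
  have hne := hS.sets_nonempty
  refine hS.induction_isD0 (P := fun n => a + n = n + a) ?_ ?_ (fun n ih => ?_) b
  · apply_rules [isD0_eq, IsTm.add, isTm_var, isTm_const]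
  · rw [hS.add_zero, hS.zero_add']
  · rw [hS.add_succ, ih, hS.succ_add']

theorem zero_mul' (a : M) : 0 * a = 0 := by
  have hne := hS.sets_nonempty
  refine hS.induction_isD0 (P := fun n => 0 * n = 0) ?_ (hS.mul_zero 0) (fun n ih => ?_) a
  · apply_rules [isD0_eq, IsTm.mul, isTm_var, isTm_const]
  · rw [hS.mul_succ, ih, hS.add_zero]

theorem mul_one' (a : M) : a * 1 = a := by
  rw [← hS.zero_add' 1, hS.mul_succ, hS.mul_zero, hS.zero_add']

theorem succ_mul' (a b : M) : (a + 1) * b = a * b + b := by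
  have hne := hS.sets_nonempty
  refine hS.induction_isD0 (P := fun n => (a + 1) * n = a * n + n) ?_ ?_ (fun n ih => ?_) b
  · apply_rules [isD0_eq, IsTm.add, IsTm.mul, isTm_var, isTm_const]
  · simp only [hS.mul_zero, hS.add_zero]
  · rw [hS.mul_succ, ih, hS.mul_succ, hS.add_succ, hS.add_succ, hS.add_assoc' _ n a,
      hS.add_comm' n a, ← hS.add_assoc']

theorem mul_comm' (a b : M) : a * b = b * a := by
  have hne := hS.sets_nonempty
  refine hS.induction_isD0 (P := fun n => a * n = n * a) ?_ ?_ (fun n ih => ?_) b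
  · apply_rules [isD0_eq, IsTm.mul, isTm_var, isTm_const]
  · rw [hS.mul_zero, hS.zero_mul']
  · rw [hS.mul_succ, ih, hS.succ_mul']

theorem mul_add' (a b c : M) : a * (b + c) = a * b + a * c := by
  have hne := hS.sets_nonempty
  refine hS.induction_isD0 (P := fun n => a * (b + n) = a * b + a * n) ?_ ?_ (fun n ih => ?_) c
  · apply_rules [isD0_eq, IsTm.add, IsTm.mul, isTm_var, isTm_const]
  · rw [hS.add_zero, hS.mul_zero, hS.add_zero]
  · rw [hS.add_succ, hS.mul_succ, ih, hS.mul_succ, hS.add_assoc']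

theorem mul_assoc' (a b c : M) : a * b * c = a * (b * c) := by
  have hne := hS.sets_nonempty
  refine hS.induction_isD0 (P := fun n => a * b * n = a * (b * n)) ?_ ?_ (fun n ih => ?_) c
  · apply_rules [isD0_eq, IsTm.mul, isTm_var, isTm_const]
  · simp only [hS.mul_zero]
  · rw [hS.mul_succ, ih, hS.mul_succ, hS.mul_add']

theorem add_cancel' (a b c : M) : a + c = b + c → a = b := by
  have hne := hS.sets_nonempty
  -- The implication is spelled with `¬` and `∧`, the connectives handled by `IsD0.not` and
  -- `IsD0.and`.
  refine hS.induction_isD0 (P := fun n => ¬ (a + n = b + n ∧ ¬ a = b)) ?_ ?_ (fun n ih => ?_) c |>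
    fun h e => by_contra fun h' => h ⟨e, h'⟩
  · apply_rules [IsD0.not, IsD0.and, isD0_eq, IsTm.add, isTm_var, isTm_const]
  · simp only [hS.add_zero]; tauto
  · rintro ⟨h, h'⟩
    rw [hS.add_succ, hS.add_succ] at h
    exact ih ⟨hS.succ_inj _ _ h, h'⟩

theorem lt_add_succ (a b : M) : a < a + b + 1 := by
  have hne := hS.sets_nonempty
  refine hS.induction_isD0 (P := fun n => a < a + n + 1) ?_ ?_ (fun n ih => ?_) b
  · apply_rules [isD0_lt, IsTm.add, isTm_var, isTm_const]
  · rw [hS.add_zero, hS.lt_succ]; exact Or.inr rfl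
  · rw [hS.lt_succ, hS.add_succ]; exact Or.inl ih

theorem exists_of_lt {a b : M} : a < b → ∃ c, b = a + c + 1 := by
  have hne := hS.sets_nonempty
  have hz : ∀ n : M, 0 < n + 1 := fun n => by
    have := hS.lt_add_succ 0 n
    rwa [hS.zero_add'] at this
  have hsucc : ∀ c n : M, c < n → c + 1 < n + 1 := by
    intro c n
    refine hS.induction_isD0 (P := fun n => ¬ (c < n ∧ ¬ c + 1 < n + 1)) ?_ ?_ (fun n ih => ?_) n |>
      fun h e => by_contra fun h' => h ⟨e, h'⟩
    · apply_rules [IsD0.not, IsD0.and, isD0_lt, IsTm.add, isTm_var, isTm_const]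
    · exact fun h => hS.not_lt_zero _ h.1
    · rintro ⟨h, h'⟩
      rcases (hS.lt_succ _ _).1 h with h | h
      · exact h' ((hS.lt_succ _ _).2 (Or.inl (by_contra fun h'' => ih ⟨h, h''⟩)))
      · exact h' ((hS.lt_succ _ _).2 (Or.inr (by rw [h])))
  intro e
  -- The bound on `c` keeps the induction formula `Σ⁰₀`.
  have h : ¬ (a < b ∧ ¬ ∃ c < b, b = a + c + 1) := by
    refine hS.induction_isD0 (P := fun n => ¬ (a < n ∧ ¬ ∃ c < n, n = a + c + 1)) ?_ ?_
      (fun n ih => ?_) b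
    · refine IsD0.not (IsD0.and (by apply_rules [isD0_lt, isTm_var, isTm_const]) (IsD0.not
        (IsD0.bex (P := fun p : (Base S × M) × M => p.1.2 = a + p.2 + 1) ?_ isTm_var)))
      apply_rules [isD0_eq, IsTm.add, isTm_var, isTm_const, isTm_var.weak]
    · exact fun h => hS.not_lt_zero _ h.1
    · rintro ⟨h, h'⟩
      rcases (hS.lt_succ _ _).1 h with h | rfl
      · obtain ⟨c, hc, e⟩ : ∃ c < n, n = a + c + 1 := by_contra fun h'' => ih ⟨h, h''⟩
        exact h' ⟨c + 1, hsucc _ _ hc, by rw [hS.add_succ, ← e]⟩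
      · exact h' ⟨0, hz _, by rw [hS.add_zero]⟩
  obtain ⟨c, -, e⟩ : ∃ c < b, b = a + c + 1 := by_contra fun h'' => h ⟨e, h''⟩
  exact ⟨c, e⟩

theorem lt_iff' {a b : M} : a < b ↔ ∃ c, b = a + c + 1 :=
  ⟨hS.exists_of_lt, by rintro ⟨c, rfl⟩; exact hS.lt_add_succ a c⟩

theorem lt_irrefl' (a : M) : ¬ a < a := by
  rw [hS.lt_iff']
  rintro ⟨c, h⟩
  rw [hS.add_assoc', hS.add_comm'] at h
  nth_rw 1 [← hS.zero_add' a] at h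
  exact hS.succ_ne_zero c (hS.add_cancel' _ _ _ h).symm

theorem lt_trans' {a b c : M} (h : a < b) (h' : b < c) : a < c := by
  obtain ⟨d, rfl⟩ := hS.lt_iff'.1 h
  obtain ⟨e, rfl⟩ := hS.lt_iff'.1 h'
  exact hS.lt_iff'.2 ⟨d + 1 + e, by rw [hS.add_assoc' a d 1, hS.add_assoc' a]⟩

theorem zero_or_succ (a : M) : a = 0 ∨ ∃ b, a = b + 1 := by
  have hne := hS.sets_nonempty
  have : ¬ (¬ a = 0 ∧ ¬ 0 < a) := by
    refine hS.induction_isD0 (P := fun n => ¬ (¬ n = 0 ∧ ¬ 0 < n)) ?_ ?_ (fun n _ => ?_) a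
    · apply_rules [IsD0.not, IsD0.and, isD0_lt, isD0_eq, isTm_var, isTm_const]
    · tauto
    · have := hS.lt_add_succ 0 n
      rw [hS.zero_add'] at this
      tauto
  by_cases h : a = 0
  · exact Or.inl h
  · have h' : 0 < a := by tauto
    obtain ⟨c, hc⟩ := hS.exists_of_lt h'
    exact Or.inr ⟨c, by rw [hc, hS.zero_add']⟩

theorem trichotomy' (a b : M) : b < a ∨ b = a ∨ a < b := by
  have hne := hS.sets_nonempty
  have : ¬ (¬ b < a ∧ ¬ b = a ∧ ¬ a < b) := by
    refine hS.induction_isD0 (P := fun n => ¬ (¬ n < a ∧ ¬ n = a ∧ ¬ a < n)) ?_ ?_ (fun n ih => ?_) b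
    · apply_rules [IsD0.not, IsD0.and, isD0_lt, isD0_eq, isTm_var, isTm_const]
    · rcases hS.zero_or_succ a with rfl | ⟨c, rfl⟩
      · tauto
      · have := hS.lt_add_succ 0 c
        rw [hS.zero_add'] at this
        tauto
    · have h1 := hS.lt_succ a n
      by_cases h : n < a
      · obtain ⟨c, rfl⟩ := hS.exists_of_lt h
        rcases hS.zero_or_succ c with rfl | ⟨d, rfl⟩
        · rw [hS.add_zero]; tauto
        · have : n + 1 < n + (d + 1) + 1 := by
            have := hS.lt_add_succ (n + 1) d
            rwa [hS.succ_add' n d, ← hS.add_succ n d] at this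
          tauto
      · by_cases e : n = a
        · have := e.symm; tauto
        · tauto
  tauto

end IsModelRCA0

open Classical in
/-- The natural order on a model of `RCA₀`. -/
noncomputable abbrev IsModelRCA0.linearOrder (hS : IsModelRCA0 S) : LinearOrder M where
  lt := (· < ·)
  le a b := a < b ∨ a = b
  le_refl a := Or.inr rfl
  le_trans a b c h h' := by
    rcases h with h | rfl
    · rcases h' with h' | rfl
      · exact Or.inl (hS.lt_trans' h h')
      · exact Or.inl h
    · exact h'
  lt_iff_le_not_ge a b := by
    have := fun h : a < b => fun h' : b < a => hS.lt_irrefl' _ (hS.lt_trans' h h')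
    have := hS.lt_irrefl' a
    constructor
    · exact fun h => ⟨Or.inl h, by rintro (h' | rfl) <;> tauto⟩
    · rintro ⟨h | rfl, h'⟩
      · exact h
      · tauto
  le_antisymm a b h h' := by
    rcases h with h | h
    · rcases h' with h' | h'
      · exact absurd (hS.lt_trans' h h') (hS.lt_irrefl' _)
      · exact h'.symm
    · exact h
  le_total a b := by
    rcases hS.trichotomy' a b with h | rfl | h <;> tauto
  toDecidableLE := Classical.decRel _

/-- The arithmetical operations of a model of `RCA₀`. -/
abbrev IsModelRCA0.commSemiring (hS : IsModelRCA0 S) : CommSemiring M where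
  add := (· + ·)
  mul := (· * ·)
  zero := 0
  one := 1
  add_assoc := hS.add_assoc'
  zero_add := hS.zero_add'
  add_zero := hS.add_zero
  add_comm := hS.add_comm'
  mul_assoc := hS.mul_assoc'
  one_mul a := by rw [hS.mul_comm', hS.mul_one']
  mul_one := hS.mul_one'
  mul_comm := hS.mul_comm'
  left_distrib := hS.mul_add'
  right_distrib a b c := by rw [hS.mul_comm', hS.mul_add', hS.mul_comm' c a, hS.mul_comm' c b]
  zero_mul := hS.zero_mul'
  mul_zero := hS.mul_zero
  nsmul := nsmulRec

end RawModel

section Model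

variable {M : Type*} [CommSemiring M] [LinearOrder M] {S : Set (Set M)} (hS : IsModelRCA0 S)
include hS

/-- Writing `a < b` as `b = a + c + 1` turns monotonicity into polynomial identities. -/
theorem IsModelRCA0.isStrictOrderedRing : IsStrictOrderedRing M := by
  have h1 : ∀ a b c : M, a < b → c + a < c + b := fun a b c h => by
    obtain ⟨d, rfl⟩ := hS.exists_of_lt h
    exact hS.lt_iff'.2 ⟨d, by ring⟩
  have h2 : ∀ a b c : M, a ≤ b → c + a ≤ c + b := fun a b c h => by
    rcases h.lt_or_eq with h | rfl
    exacts [(h1 _ _ _ h).le, le_rfl]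
  have h3 : ∀ a : M, 0 < a → ∀ b c, b < c → a * b < a * c := fun a ha b c h => by
    obtain ⟨d, rfl⟩ := hS.exists_of_lt h
    obtain ⟨e, rfl⟩ := hS.exists_of_lt ha
    exact hS.lt_iff'.2 ⟨e * d + e + d, by ring⟩
  have h01 : (0 : M) < 1 := hS.lt_iff'.2 ⟨0, by ring⟩
  exact
    { add_le_add_left := fun a b h c => by rw [add_comm a, add_comm b]; exact h2 a b c h
      le_of_add_le_add_left := fun a b c h => by
        by_contra h'
        exact absurd (h1 _ _ a (not_le.1 h')) (not_lt.2 h)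
      zero_le_one := h01.le
      exists_pair_ne := ⟨0, 1, h01.ne⟩
      mul_lt_mul_of_pos_left := fun a ha b c h => h3 a ha b c h
      mul_lt_mul_of_pos_right := fun a ha b c h => by
        rw [mul_comm b, mul_comm c]; exact h3 a ha b c h }

theorem IsModelRCA0.canonicallyOrderedAdd : CanonicallyOrderedAdd M := by
  have := hS.isStrictOrderedRing
  have h0 : ∀ a : M, 0 ≤ a := fun a => not_lt.1 (hS.not_lt_zero a)
  exact
    { exists_add_of_le := fun {a b} h => by
        rcases h.lt_or_eq with h | rfl
        · obtain ⟨c, rfl⟩ := hS.exists_of_lt h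
          exact ⟨c + 1, by ring⟩
        · exact ⟨0, by ring⟩
      le_add_self := fun a b => le_add_of_nonneg_left (h0 b)
      le_self_add := fun a b => le_add_of_nonneg_right (h0 b) }

end Model

/-- There are no elements strictly between `a` and `a + 1`. -/
class IsDiscrete (M : Type*) [Add M] [One M] [LT M] [LE M] : Prop where
  add_one_le {a b : M} : a < b → a + 1 ≤ b

theorem IsModelRCA0.isDiscrete {M : Type*} [CommSemiring M] [LinearOrder M] {S : Set (Set M)}
    (hS : IsModelRCA0 S) : IsDiscrete M :=
  have := hS.isStrictOrderedRing
  have := hS.canonicallyOrderedAdd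
  ⟨fun h => by
    obtain ⟨c, rfl⟩ := hS.exists_of_lt h
    rw [add_right_comm]
    exact le_self_add⟩

/-! ### `Σ⁰₁` and `Δ⁰₁` predicates -/

section Definability

variable {M : Type*} [CommSemiring M] [LinearOrder M] [IsStrictOrderedRing M]
  [CanonicallyOrderedAdd M] {S : Set (Set M)} {Γ Δ : Type*} [Ctx S Γ] [Ctx S Δ]

variable (S) in
/-- The predicate `P` is defined by a `Σ⁰₁` formula with parameters. -/
def IsSigma (P : Γ → Prop) : Prop :=
  ∃ P0 : Γ × M → Prop, IsD0 S P0 ∧ ∀ γ, P γ ↔ ∃ k, P0 (γ, k)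

theorem IsSigma.congr {P P' : Γ → Prop} (hP : IsSigma S P) (h : ∀ γ, P' γ ↔ P γ) :
    IsSigma S P' := by
  obtain ⟨P0, h0, hP⟩ := hP
  exact ⟨P0, h0, fun γ => (h γ).trans (hP γ)⟩

theorem IsSigma.comp {P : Δ → Prop} (hP : IsSigma S P) {g : Γ → Δ} (hg : IsRen S g) :
    IsSigma S (fun γ => P (g γ)) := by
  obtain ⟨P0, h0, hP⟩ := hP
  exact ⟨fun p => P0 (g p.1, p.2), h0.comp hg.lift, fun γ => hP (g γ)⟩

theorem IsD0.isSigma {P : Γ → Prop} (hP : IsD0 S P) : IsSigma S P :=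
  ⟨fun p => P p.1, hP.comp isRen_fst, fun _ => ⟨fun h => ⟨0, h⟩, fun ⟨_, h⟩ => h⟩⟩

theorem IsSigma.or {P P' : Γ → Prop} (hP : IsSigma S P) (hP' : IsSigma S P') :
    IsSigma S (fun γ => P γ ∨ P' γ) := by
  obtain ⟨P0, h0, hP⟩ := hP
  obtain ⟨P1, h1, hP'⟩ := hP'
  exact ⟨_, h0.or h1, fun γ => by simp only [hP, hP', exists_or]⟩

/-- Two unbounded quantifiers are contracted into one over a common strict upper bound of both
witnesses. -/
theorem IsSigma.ex {P : Γ × M → Prop} (hP : IsSigma S P) : IsSigma S (fun γ => ∃ x, P (γ, x)) := by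
  obtain ⟨P0, h0, hP⟩ := hP
  refine ⟨fun p => ∃ x < p.2, ∃ k < p.2, P0 ((p.1, x), k),
    IsD0.bex (P := fun q : (Γ × M) × M => ∃ k < q.1.2, P0 ((q.1.1, q.2), k))
      (IsD0.bex (P := fun q : ((Γ × M) × M) × M => P0 ((q.1.1.1, q.1.2), q.2)) ?_ isTm_var.weak)
        isTm_var, fun γ => ?_⟩
  · exact h0.comp isRen_fst.lift.lift
  · simp only [hP]
    constructor
    · rintro ⟨x, k, h⟩
      exact ⟨max x k + 1, x, (le_max_left _ _).trans_lt (lt_add_one _), k,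
        (le_max_right _ _).trans_lt (lt_add_one _), h⟩
    · rintro ⟨K, x, -, k, -, h⟩
      exact ⟨x, k, h⟩

theorem IsSigma.and {P P' : Γ → Prop} (hP : IsSigma S P) (hP' : IsSigma S P') :
    IsSigma S (fun γ => P γ ∧ P' γ) := by
  obtain ⟨P0, h0, hP⟩ := hP
  obtain ⟨P1, h1, hP'⟩ := hP'
  have : IsSigma S (fun γ => ∃ x y, P0 (γ, x) ∧ P1 (γ, y)) :=
    IsSigma.ex (P := fun p => ∃ y, P0 p ∧ P1 (p.1, y)) (IsSigma.ex
      (P := fun p => P0 p.1 ∧ P1 (p.1.1, p.2))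
      ((h0.comp isRen_fst).and (h1.comp isRen_fst.lift)).isSigma)
  exact this.congr fun γ => by simp only [hP, hP']; exact exists_and_exists_comm

variable [hS : Fact (IsModelRCA0 S)]

theorem IsSigma.induction {P : Γ → M → Prop} (hP : IsSigma S (fun p : Γ × M => P p.1 p.2)) {γ : Γ}
    (h0 : P γ 0) (hs : ∀ n, P γ n → P γ (n + 1)) (n : M) : P γ n := by
  obtain ⟨P0, ⟨φ, v, A, hA, h⟩, hP⟩ := hP
  have key : ∀ n, P γ n ↔ ∃ k, φ.eval (cons (Ctx.param S γ) A) (cons k (cons n (Ctx.env S γ v))) :=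
    fun n => (hP (γ, n)).trans (exists_congr fun k => h ((γ, n), k))
  simp only [key] at h0 hs ⊢
  refine hS.out.sigma_one_induction φ _ _ (fun i => ?_) h0 hs n
  cases i
  exacts [Ctx.param_mem γ, hA _]

/-- This is `Σ⁰₁` bounding: `Σ⁰₁` induction along the bounded quantifier yields one bound `K` for
all witnesses. -/
theorem IsSigma.ball_var {P : Γ × M → Prop} (hP : IsSigma S P) :
    IsSigma S (fun p : Γ × M => ∀ x < p.2, P (p.1, x)) := by
  have hne := hS.out.sets_nonempty
  obtain ⟨P0, h0, hP⟩ := hP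
  have hD : IsD0 S (fun p : (Γ × M) × M => ∀ x < p.1.2, ∃ k < p.2, P0 ((p.1.1, x), k)) :=
    IsD0.ball (P := fun p : ((Γ × M) × M) × M => ∃ k < p.1.2, P0 ((p.1.1.1, p.2), k))
      (IsD0.bex (P := fun p : (((Γ × M) × M) × M) × M => P0 ((p.1.1.1.1, p.1.2), p.2))
        (h0.comp isRen_fst.weak.lift.lift) isTm_var.weak) isTm_var.weak
  refine ⟨_, hD, fun p => ?_⟩
  simp only [hP]
  constructor
  · intro h
    obtain ⟨γ, y⟩ := p
    -- The disjunct `y < n` lets the induction run past `y`, where no witnesses are given.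
    have hI : IsSigma S (fun q : (Γ × M) × M =>
        ∃ K, q.1.2 < q.2 ∨ ∀ x < q.2, ∃ k < K, P0 ((q.1.1, x), k)) :=
      IsSigma.ex (P := fun q : ((Γ × M) × M) × M =>
        q.1.1.2 < q.1.2 ∨ ∀ x < q.1.2, ∃ k < q.2, P0 ((q.1.1.1, x), k))
        ((isD0_lt hne isTm_var.weak.weak isTm_var.weak).or
          (hD.comp (isRen_fst (S := S) (Γ := Γ)).lift.lift)).isSigma
    obtain ⟨K, hK⟩ := hI.induction (P := fun a n =>
        ∃ K, a.2 < n ∨ ∀ x < n, ∃ k < K, P0 ((a.1, x), k)) (γ := (γ, y))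
      ⟨0, Or.inr fun x hx => absurd hx (hS.out.not_lt_zero x)⟩ (fun n ⟨K, hK⟩ => by
        rcases hK with hK | hK
        · exact ⟨0, Or.inl (hK.trans (lt_add_one _))⟩
        · rcases lt_or_ge n y with hn | hn
          · obtain ⟨k, hk⟩ := h n hn
            refine ⟨max K (k + 1), Or.inr fun x hx => ?_⟩
            rcases (hS.out.lt_succ _ _).1 hx with hx | rfl
            · obtain ⟨k', hk', hk''⟩ := hK x hx
              exact ⟨k', hk'.trans_le (le_max_left _ _), hk''⟩
            · exact ⟨k, (lt_add_one k).trans_le (le_max_right _ _), hk⟩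
          · exact ⟨0, Or.inl (hn.trans_lt (lt_add_one _))⟩) y
    exact ⟨K, hK.resolve_left (lt_irrefl _)⟩
  · rintro ⟨K, h⟩ x hx
    obtain ⟨k, -, hk⟩ := h x hx
    exact ⟨k, hk⟩

/-! ### Recursive functions -/

variable (S) in
/-- The predicate `P` is defined by a `Δ⁰₁` formula with parameters. -/
class IsDelta (P : Γ → Prop) : Prop where
  pos : IsSigma S P
  neg : IsSigma S (fun γ => ¬ P γ)

variable (S) in
/-- The graph of the function `f` is defined by a `Σ⁰₁` formula with parameters. -/
class IsRec (f : Γ → M) : Prop where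
  graph : IsSigma S (fun p : Γ × M => f p.1 = p.2)

/-- Substituting a total function with `Σ⁰₁` graph costs one existential quantifier. Applied to a
predicate and to its negation, it preserves `Δ⁰₁`. -/
theorem IsSigma.subst {P : Γ × M → Prop} (hP : IsSigma S P) (f : Γ → M) [hf : IsRec S f] :
    IsSigma S (fun γ => P (γ, f γ)) :=
  (IsSigma.ex (hf.graph.and hP)).congr fun γ => by simp

theorem IsD0.isDelta {P : Γ → Prop} (hP : IsD0 S P) : IsDelta S P := ⟨hP.isSigma, hP.not.isSigma⟩

theorem IsTm.isRec {f : Γ → M} (hf : IsTm S f) : IsRec S f :=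
  ⟨(isD0_eq hS.out.sets_nonempty hf.weak isTm_var).isSigma⟩

theorem IsDelta.congr {P P' : Γ → Prop} (hP : IsDelta S P) (h : ∀ γ, P' γ ↔ P γ) :
    IsDelta S P' := ⟨hP.pos.congr h, hP.neg.congr fun γ => not_congr (h γ)⟩

theorem IsDelta.comp {P : Δ → Prop} (hP : IsDelta S P) {g : Γ → Δ} (hg : IsRen S g) :
    IsDelta S (fun γ => P (g γ)) := ⟨hP.pos.comp hg, hP.neg.comp hg⟩

theorem IsDelta.subst {P : Γ × M → Prop} (hP : IsDelta S P) (f : Γ → M) [hf : IsRec S f] :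
    IsDelta S (fun γ => P (γ, f γ)) := ⟨hP.pos.subst f, hP.neg.subst f⟩

theorem IsDelta.subst₂ {P : (Γ × M) × M → Prop} (hP : IsDelta S P) (f g : Γ → M) [hf : IsRec S f]
    [hg : IsRec S g] : IsDelta S (fun γ => P ((γ, f γ), g γ)) := by
  have : IsRec S (fun p : Γ × M => g p.1) := ⟨hg.graph.comp isRen_fst.lift⟩
  exact (hP.subst (fun p : Γ × M => g p.1)).subst f

theorem IsRec.comp {f : Δ → M} (hf : IsRec S f) {g : Γ → Δ} (hg : IsRen S g) :
    IsRec S (fun γ => f (g γ)) := ⟨hf.graph.comp hg.lift⟩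

theorem IsRec.subst {f : Γ × M → M} (hf : IsRec S f) (g : Γ → M) [hg : IsRec S g] :
    IsRec S (fun γ => f (γ, g γ)) := by
  have : IsRec S (fun p : Γ × M => g p.1) := hg.comp isRen_fst
  -- Only the innermost variable can be substituted, so the argument of `f` is first exchanged with
  -- its value.
  exact ⟨(hf.graph.comp (g := fun p : (Γ × M) × M => ((p.1.1, p.2), p.1.2))
    ⟨fun _ => rfl, fun i => Nat.casesOn i 1 fun i => Nat.casesOn i 0 fun i => i + 2,
      fun γ v i => by rcases i with _ | _ | i <;> rfl⟩).subst (fun p : Γ × M => g p.1)⟩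

theorem IsRec.subst₂ {f : (Γ × M) × M → M} (hf : IsRec S f) (g h : Γ → M) [hg : IsRec S g]
    [hh : IsRec S h] : IsRec S (fun γ => f ((γ, g γ), h γ)) := by
  have : IsRec S (fun p : Γ × M => h p.1) := hh.comp isRen_fst
  exact (hf.subst (fun p : Γ × M => h p.1)).subst g

instance isRec_const (a : M) : IsRec S (fun _ : Γ => a) := (isTm_const a).isRec

instance isRec_var0 : IsRec S (fun p : Γ × M => p.2) := isTm_var.isRec

instance isRec_var1 : IsRec S (fun p : (Γ × M) × M => p.1.2) := isTm_var.weak.isRec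

instance isRec_var2 : IsRec S (fun p : ((Γ × M) × M) × M => p.1.1.2) := isTm_var.weak.weak.isRec

instance isRec_var3 : IsRec S (fun p : (((Γ × M) × M) × M) × M => p.1.1.1.2) :=
  isTm_var.weak.weak.weak.isRec

instance isRec_weak1 (f : Γ → M) [hf : IsRec S f] : IsRec S (fun p : Γ × M => f p.1) :=
  hf.comp isRen_fst

instance isRec_weak2 (f : Γ → M) [hf : IsRec S f] : IsRec S (fun p : (Γ × M) × M => f p.1.1) :=
  hf.comp isRen_fst.weak

instance isRec_weak3 (f : Γ → M) [hf : IsRec S f] :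
    IsRec S (fun p : ((Γ × M) × M) × M => f p.1.1.1) :=
  hf.comp isRen_fst.weak.weak

instance isRec_add (f g : Γ → M) [IsRec S f] [IsRec S g] : IsRec S (fun γ => f γ + g γ) :=
  IsRec.subst₂ (f := fun p : (Γ × M) × M => p.1.2 + p.2) (isTm_var.weak.add isTm_var).isRec f g

instance isRec_mul (f g : Γ → M) [IsRec S f] [IsRec S g] : IsRec S (fun γ => f γ * g γ) :=
  IsRec.subst₂ (f := fun p : (Γ × M) × M => p.1.2 * p.2) (isTm_var.weak.mul isTm_var).isRec f g

/-! ### Closure properties of `Δ⁰₁` predicates -/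

instance isDelta_eq (f g : Γ → M) [IsRec S f] [IsRec S g] : IsDelta S (fun γ => f γ = g γ) :=
  IsDelta.subst₂ (P := fun p : (Γ × M) × M => p.1.2 = p.2)
    (isD0_eq hS.out.sets_nonempty isTm_var.weak isTm_var).isDelta f g

instance isDelta_lt (f g : Γ → M) [IsRec S f] [IsRec S g] : IsDelta S (fun γ => f γ < g γ) :=
  IsDelta.subst₂ (P := fun p : (Γ × M) × M => p.1.2 < p.2)
    (isD0_lt hS.out.sets_nonempty isTm_var.weak isTm_var).isDelta f g

instance isDelta_param (f : Γ → M) [IsRec S f] : IsDelta S (fun γ => f γ ∈ Ctx.param S γ) :=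
  IsDelta.subst (P := fun p : Γ × M => p.2 ∈ Ctx.param S p.1)
    (isD0_mem_param hS.out.sets_nonempty isTm_var).isDelta f

instance isDelta_mem (U : Set M) [hU : Fact (U ∈ S)] (f : Γ → M) [IsRec S f] :
    IsDelta S (fun γ => f γ ∈ U) :=
  IsDelta.subst (P := fun p : Γ × M => p.2 ∈ U) (isD0_mem hU.out isTm_var).isDelta f

instance isDelta_not (P : Γ → Prop) [hP : IsDelta S P] : IsDelta S (fun γ => ¬ P γ) :=
  ⟨hP.neg, hP.pos.congr fun _ => not_not⟩

instance isDelta_and (P P' : Γ → Prop) [hP : IsDelta S P] [hP' : IsDelta S P'] :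
    IsDelta S (fun γ => P γ ∧ P' γ) :=
  ⟨hP.pos.and hP'.pos, (hP.neg.or hP'.neg).congr fun _ => not_and_or⟩

instance isDelta_or (P P' : Γ → Prop) [hP : IsDelta S P] [hP' : IsDelta S P'] :
    IsDelta S (fun γ => P γ ∨ P' γ) :=
  ⟨hP.pos.or hP'.pos, (hP.neg.and hP'.neg).congr fun _ => not_or⟩

instance isDelta_imp (P P' : Γ → Prop) [hP : IsDelta S P] [hP' : IsDelta S P'] :
    IsDelta S (fun γ => P γ → P' γ) :=
  (isDelta_or (fun γ => ¬ P γ) P').congr fun _ => imp_iff_not_or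

instance isDelta_iff (P P' : Γ → Prop) [hP : IsDelta S P] [hP' : IsDelta S P'] :
    IsDelta S (fun γ => P γ ↔ P' γ) :=
  (isDelta_and (fun γ => P γ → P' γ) (fun γ => P' γ → P γ)).congr fun _ => iff_iff_implies_and_implies

instance isDelta_le (f g : Γ → M) [IsRec S f] [IsRec S g] : IsDelta S (fun γ => f γ ≤ g γ) :=
  (isDelta_not (fun γ => g γ < f γ)).congr fun _ => not_lt.symm

theorem IsSigma.ball {P : Γ → M → Prop} (hP : IsSigma S (fun p : Γ × M => P p.1 p.2)) (b : Γ → M)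
    [IsRec S b] : IsSigma S (fun γ => ∀ x < b γ, P γ x) :=
  hP.ball_var.subst b

instance isDelta_bex (b : Γ → M) (P : Γ → M → Prop) [IsRec S b]
    [hP : IsDelta S (fun p : Γ × M => P p.1 p.2)] : IsDelta S (fun γ => ∃ x < b γ, P γ x) :=
  ⟨IsSigma.ex (P := fun p : Γ × M => p.2 < b p.1 ∧ P p.1 p.2)
    ((isDelta_lt (fun p : Γ × M => p.2) (fun p => b p.1)).pos.and hP.pos),
    (IsSigma.ball (P := fun γ x => ¬ P γ x) hP.neg b).congr fun γ => by push Not; rfl⟩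

instance isDelta_ball (b : Γ → M) (P : Γ → M → Prop) [IsRec S b]
    [hP : IsDelta S (fun p : Γ × M => P p.1 p.2)] : IsDelta S (fun γ => ∀ x < b γ, P γ x) :=
  (isDelta_not (fun γ => ∃ x < b γ, ¬ P γ x)).congr fun γ => by push Not; rfl

/-! ### Comprehension and least number principle -/

theorem IsDelta.setOf_mem {P : Γ → M → Prop} (hP : IsDelta S (fun p : Γ × M => P p.1 p.2)) (γ : Γ) :
    {n | P γ n} ∈ S := by
  obtain ⟨⟨P0, h0, hP0⟩, ⟨P1, h1, hP1⟩⟩ := hP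
  obtain ⟨φ, ψ, v, A, hA, h⟩ := h0.merge h1.not
  have key : ∀ n, P γ n ↔ ∃ k, φ.eval (cons (Ctx.param S γ) A) (cons k (cons n (Ctx.env S γ v))) :=
    fun n => (hP0 (γ, n)).trans (exists_congr fun k => (h ((γ, n), k)).1)
  have key' : ∀ n, P γ n ↔ ∀ k, ψ.eval (cons (Ctx.param S γ) A)
      (cons k (cons n (Ctx.env S γ v))) := fun n => by
    have := (hP1 (γ, n)).not
    push Not at this
    exact this.trans (forall_congr' fun k => (h ((γ, n), k)).2)
  have := hS.out.delta_one_comprehension φ ψ (Ctx.env S γ v) (cons (Ctx.param S γ) A)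
    (fun i => by cases i; exacts [Ctx.param_mem γ, hA _])
    (fun n => (key n).symm.trans (key' n))
  simpa only [← key] using this

/-- Without a least element one could descend forever: by induction on `n` there is `x` with `P x`
and `x + n ≤ a`, which is absurd for `n = a + 1`. -/
theorem IsSigma.exists_least {P : Γ → M → Prop} (hP : IsSigma S (fun p : Γ × M => P p.1 p.2))
    {γ : Γ} {a : M} (ha : P γ a) : ∃ x, P γ x ∧ ∀ y < x, ¬ P γ y := by
  by_contra! H
  have hI : IsSigma S (fun q : (Γ × M) × M => ∃ x, x + q.2 ≤ q.1.2 ∧ P q.1.1 x) :=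
    IsSigma.ex (P := fun q : ((Γ × M) × M) × M => q.2 + q.1.2 ≤ q.1.1.2 ∧ P q.1.1.1 q.2)
      (IsSigma.and IsDelta.pos
        (hP.comp (g := fun q : ((Γ × M) × M) × M => (q.1.1.1, q.2)) isRen_fst.weak.lift))
  obtain ⟨x, hx, -⟩ := hI.induction (P := fun q n => ∃ x, x + n ≤ q.2 ∧ P q.1 x) (γ := (γ, a))
    ⟨a, by simp, ha⟩ (fun n ⟨x, hx, hPx⟩ => by
      obtain ⟨y, hy, hPy⟩ := H x hPx
      obtain ⟨d, rfl⟩ := hS.out.exists_of_lt hy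
      refine ⟨y, le_trans ?_ hx, hPy⟩
      calc y + (n + 1) ≤ y + (n + 1) + d := le_self_add
        _ = y + d + 1 + n := by ring) (a + 1)
  exact absurd (le_add_self.trans hx : a + 1 ≤ a) (not_le.2 (lt_add_one a))

theorem IsDelta.strong_induction {P : Γ → M → Prop} (hP : IsDelta S (fun p : Γ × M => P p.1 p.2))
    {γ : Γ} (h : ∀ n, (∀ m < n, P γ m) → P γ n) (n : M) : P γ n := by
  by_contra hn
  obtain ⟨x, hx, hx'⟩ := IsSigma.exists_least (P := fun γ n => ¬ P γ n) hP.neg hn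
  exact hx (h x fun m hm => not_not.1 (hx' m hm))

/-- Bounded search: the least `x < b` with `P x`, or `b` if there is none. -/
noncomputable def bmin (b : M) (P : M → Prop) : M :=
  open Classical in if h : ∃ x < b, P x ∧ ∀ y < x, ¬ P y then h.choose else b

theorem bmin_eq {b x : M} {P : M → Prop} (h : P x) (hb : x < b) (h' : ∀ y < x, ¬ P y) :
    bmin b P = x := by
  have H : ∃ x < b, P x ∧ ∀ y < x, ¬ P y := ⟨x, hb, h, h'⟩
  rw [bmin, dif_pos H]
  obtain ⟨-, h1, h2⟩ := H.choose_spec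
  exact le_antisymm (not_lt.1 fun hx => h2 x hx h) (not_lt.1 fun hx => h' _ hx h1)

theorem bmin_eq_of_unique {b x : M} {P : M → Prop} (h : P x) (hb : x < b) (h' : ∀ y, P y → y = x) :
    bmin b P = x :=
  bmin_eq h hb fun y hy hP => hy.ne (h' y hP)

/-- The second case excludes only a least witness, so that no definability of `P` is needed. -/
theorem bmin_cases (b : M) (P : M → Prop) :
    bmin b P < b ∧ P (bmin b P) ∧ (∀ y < bmin b P, ¬ P y) ∨
      bmin b P = b ∧ ¬ ∃ x < b, P x ∧ ∀ y < x, ¬ P y := by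
  by_cases h : ∃ x < b, P x ∧ ∀ y < x, ¬ P y
  · rw [bmin, dif_pos h]
    exact Or.inl h.choose_spec
  · rw [bmin, dif_neg h]
    exact Or.inr ⟨rfl, h⟩

theorem bmin_spec {P : Γ → M → Prop} (hP : IsDelta S (fun p : Γ × M => P p.1 p.2)) (γ : Γ) {b x : M}
    (h : P γ x) (hb : x < b) : bmin b (P γ) < b ∧ P γ (bmin b (P γ)) := by
  obtain ⟨y, hy, hy'⟩ := hP.pos.exists_least h
  have hxy : y ≤ x := not_lt.1 fun hx => hy' x hx h
  rw [bmin_eq hy (hxy.trans_lt hb) hy']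
  exact ⟨hxy.trans_lt hb, hy⟩

instance isRec_bmin (b : Γ → M) (P : Γ → M → Prop) [hb : IsRec S b]
    [hP : IsDelta S (fun p : Γ × M => P p.1 p.2)] : IsRec S (fun γ => bmin (b γ) (P γ)) := by
  have h1 : IsDelta S (fun p : (Γ × M) × M => P p.1.1 p.2) := hP.comp isRen_fst.lift
  have h2 : IsDelta S (fun p : ((Γ × M) × M) × M => P p.1.1.1 p.2) := hP.comp isRen_fst.weak.lift
  have : IsDelta S (fun p : Γ × M => p.2 < b p.1 ∧ P p.1 p.2 ∧ (∀ y < p.2, ¬ P p.1 y) ∨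
      p.2 = b p.1 ∧ ¬ ∃ x < b p.1, P p.1 x ∧ ∀ y < x, ¬ P p.1 y) := inferInstance
  refine ⟨this.pos.congr fun ⟨γ, y⟩ => ?_⟩
  dsimp only
  constructor
  · rintro rfl
    exact bmin_cases _ _
  · rintro (⟨h1, h2, h3⟩ | ⟨rfl, h⟩)
    · exact bmin_eq h2 h1 h3
    · exact dif_neg h

open Classical in
instance isRec_ite (P : Γ → Prop) (f g : Γ → M) [IsDelta S P] [IsRec S f] [IsRec S g] :
    IsRec S (fun γ => if P γ then f γ else g γ) := by
  have : IsDelta S (fun p : Γ × M => P p.1) := IsDelta.comp inferInstance isRen_fst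
  have : IsDelta S (fun p : Γ × M => P p.1 ∧ f p.1 = p.2 ∨ ¬ P p.1 ∧ g p.1 = p.2) := inferInstance
  refine ⟨this.pos.congr fun ⟨γ, y⟩ => ?_⟩
  by_cases h : P γ <;> simp [h]

/-! ### Induction, comprehension and minimization for predicates of one number -/

theorem induction_sigma {P : M → Prop} (hP : IsSigma S (fun p : Base S × M => P p.2)) (h0 : P 0)
    (hs : ∀ n, P n → P (n + 1)) (n : M) : P n :=
  IsSigma.induction (P := fun _ n => P n) hP
    (γ := ⟨hS.out.sets_nonempty.some, hS.out.sets_nonempty.some_mem, trivial⟩) h0 hs n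

theorem induction_delta {P : M → Prop} (hP : IsDelta S (fun p : Base S × M => P p.2)) (h0 : P 0)
    (hs : ∀ n, P n → P (n + 1)) (n : M) : P n :=
  induction_sigma hP.pos h0 hs n

theorem strong_induction_delta {P : M → Prop} (hP : IsDelta S (fun p : Base S × M => P p.2))
    (h : ∀ n, (∀ m < n, P m) → P n) (n : M) : P n :=
  IsDelta.strong_induction (P := fun _ n => P n) hP
    (γ := ⟨hS.out.sets_nonempty.some, hS.out.sets_nonempty.some_mem, trivial⟩) h n

theorem setOf_mem_delta {P : M → Prop} (hP : IsDelta S (fun p : Base S × M => P p.2)) :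
    {n | P n} ∈ S :=
  IsDelta.setOf_mem (P := fun _ n => P n) hP
    ⟨hS.out.sets_nonempty.some, hS.out.sets_nonempty.some_mem, trivial⟩

theorem exists_least_sigma {P : M → Prop} (hP : IsSigma S (fun p : Base S × M => P p.2)) {a : M}
    (ha : P a) : ∃ x, P x ∧ ∀ y < x, ¬ P y :=
  IsSigma.exists_least (P := fun _ n => P n) hP
    (γ := ⟨hS.out.sets_nonempty.some, hS.out.sets_nonempty.some_mem, trivial⟩) ha

theorem bmin_spec_delta {P : M → Prop} (hP : IsDelta S (fun p : Base S × M => P p.2)) {b x : M}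
    (h : P x) (hb : x < b) : bmin b P < b ∧ P (bmin b P) :=
  bmin_spec (P := fun _ n => P n) hP
    ⟨hS.out.sets_nonempty.some, hS.out.sets_nonempty.some_mem, trivial⟩ h hb

end Definability

set_option synthInstance.maxHeartbeats 400000
set_option synthInstance.maxSize 4000

section Coding

variable {M : Type*} [CommSemiring M] [LinearOrder M] [IsStrictOrderedRing M]
  [CanonicallyOrderedAdd M] [IsDiscrete M]

/-! ### Pairs -/

theorem lt_add_one_iff' {a b : M} : a < b + 1 ↔ a ≤ b :=
  ⟨fun h => not_lt.1 fun h' => absurd (h.trans_le (IsDiscrete.add_one_le h')) (lt_irrefl _),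
    fun h => h.trans_lt (lt_add_one b)⟩

theorem one_le_of_pos {a : M} (h : 0 < a) : 1 ≤ a := by
  simpa using IsDiscrete.add_one_le h

theorem le_mul_self' (a : M) : a ≤ a * a := by
  rcases (zero_le (a := a)).eq_or_lt with rfl | h
  · simp
  · exact le_mul_of_one_le_left zero_le (one_le_of_pos h)

/-- The code `pair m n` lies between the consecutive squares of `m + n` and `m + n + 1`. -/
theorem pair_lt_pair_of_sum {m n m' n' : M} (h : m + n < m' + n') : pair m n < pair m' n' := by
  have h1 := IsDiscrete.add_one_le h
  have hm : m ≤ m + n := le_self_add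
  calc pair m n ≤ (m + n) * (m + n) + (m + n) := add_le_add_right hm _
    _ < (m + n) * (m + n) + (m + n) + 1 := lt_add_one _
    _ ≤ (m + n) * (m + n) + (m + n) + 1 + (m + n) := le_self_add
    _ = (m + n + 1) * (m + n + 1) := by ring
    _ ≤ (m' + n') * (m' + n') := mul_le_mul' h1 h1
    _ ≤ pair m' n' := le_self_add

theorem pair_lt_pair_of_fst {m n m' n' : M} (h : m + n = m' + n') (hm : m < m') :
    pair m n < pair m' n' := by
  unfold pair
  rw [h]
  exact add_lt_add_right hm _

theorem pair_lt_pair_left {m m' : M} (n : M) (h : m < m') : pair m n < pair m' n :=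
  pair_lt_pair_of_sum (add_lt_add_left h _)

theorem pair_lt_pair_right (m : M) {n n' : M} (h : n < n') : pair m n < pair m n' :=
  pair_lt_pair_of_sum (add_lt_add_right h _)

theorem pair_inj {m n m' n' : M} : pair m n = pair m' n' ↔ m = m' ∧ n = n' := by
  refine ⟨fun h => ?_, by rintro ⟨rfl, rfl⟩; rfl⟩
  have hs : m + n = m' + n' := by
    rcases lt_trichotomy (m + n) (m' + n') with h' | h' | h'
    · exact absurd h (pair_lt_pair_of_sum h').ne
    · exact h'
    · exact absurd h (pair_lt_pair_of_sum h').ne'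
  have hm : m = m' := by
    unfold pair at h
    rw [hs] at h
    exact add_left_cancel h
  subst hm
  exact ⟨rfl, add_left_cancel hs⟩

theorem left_le_pair (m n : M) : m ≤ pair m n := le_add_self

theorem right_le_pair (m n : M) : n ≤ pair m n :=
  (le_add_self.trans (le_mul_self' (m + n))).trans le_self_add

/-- This makes quantifiers over elements of coded sets bounded, and recursion along codes
well-founded. -/
theorem Elem.lt {i k : M} (h : Elem i k) : i < k := by
  obtain ⟨p, m, n, rfl, h, -⟩ := h
  exact h.trans_le ((left_le_pair p m).trans (left_le_pair _ n))

theorem lt_of_mem_finSet {i k : M} (h : i ∈ finSet k) : i < k := Elem.lt h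

theorem IsEntry.lt {b s : M} (h : IsEntry b s) : b < s := by
  obtain ⟨i, h⟩ := h
  exact (right_le_pair i b).trans_lt (lt_of_mem_finSet h)

/-! ### Definability of the basic notions -/

variable {S : Set (Set M)} [hS : Fact (IsModelRCA0 S)] {Γ : Type*} [Ctx S Γ]

instance isRec_pair (f g : Γ → M) [IsRec S f] [IsRec S g] : IsRec S (fun γ => pair (f γ) (g γ)) :=
  inferInstanceAs (IsRec S fun γ => (f γ + g γ) * (f γ + g γ) + f γ)

theorem dvd_iff_exists_lt {a b : M} : a ∣ b ↔ ∃ c < b + 1, b = a * c := by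
  constructor
  · rintro ⟨c, rfl⟩
    rcases (zero_le (a := a)).eq_or_lt with rfl | h
    · exact ⟨0, by simp, by simp⟩
    · exact ⟨c, lt_add_one_iff'.2 (le_mul_of_one_le_left zero_le (one_le_of_pos h)), rfl⟩
  · rintro ⟨c, -, h⟩
    exact ⟨c, h⟩

instance isDelta_dvd (f g : Γ → M) [IsRec S f] [IsRec S g] : IsDelta S (fun γ => f γ ∣ g γ) :=
  IsDelta.congr (P := fun γ => ∃ c < g γ + 1, g γ = f γ * c) inferInstance
    fun _ => dvd_iff_exists_lt

theorem mem_finSet_iff {i k : M} : i ∈ finSet k ↔ ∃ p < k + 1, ∃ m < k + 1, ∃ n < k + 1,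
    k = pair (pair p m) n ∧ i < p ∧ m * (i + 1) + 1 ∣ n := by
  constructor
  · rintro ⟨p, m, n, rfl, h, h'⟩
    exact ⟨p, lt_add_one_iff'.2 ((left_le_pair p m).trans (left_le_pair _ n)), m,
      lt_add_one_iff'.2 ((right_le_pair p m).trans (left_le_pair _ n)), n,
      lt_add_one_iff'.2 (right_le_pair _ n), rfl, h, h'⟩
  · rintro ⟨p, -, m, -, n, -, h⟩
    exact ⟨p, m, n, h⟩

instance isDelta_mem_finSet (f g : Γ → M) [IsRec S f] [IsRec S g] :
    IsDelta S (fun γ => f γ ∈ finSet (g γ)) :=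
  IsDelta.congr (P := fun γ => ∃ p < g γ + 1, ∃ m < g γ + 1, ∃ n < g γ + 1,
    g γ = pair (pair p m) n ∧ f γ < p ∧ m * (f γ + 1) + 1 ∣ n) inferInstance
    fun _ => mem_finSet_iff

instance isDelta_ball_finSet (b : Γ → M) (P : Γ → M → Prop) [IsRec S b]
    [hP : IsDelta S (fun p : Γ × M => P p.1 p.2)] : IsDelta S (fun γ => ∀ x ∈ finSet (b γ), P γ x) :=
  IsDelta.congr (P := fun γ => ∀ x < b γ, x ∈ finSet (b γ) → P γ x) inferInstance
    fun _ => ⟨fun h x _ hx => h x hx, fun h x hx => h x (lt_of_mem_finSet hx) hx⟩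

instance isDelta_finSet_eq (f g : Γ → M) [IsRec S f] [IsRec S g] :
    IsDelta S (fun γ => finSet (f γ) = finSet (g γ)) :=
  IsDelta.congr (P := fun γ => (∀ x ∈ finSet (f γ), x ∈ finSet (g γ)) ∧
    ∀ x ∈ finSet (g γ), x ∈ finSet (f γ)) inferInstance fun _ => Set.Subset.antisymm_iff

instance isDelta_isFinSetCode (f : Γ → M) [IsRec S f] : IsDelta S (fun γ => IsFinSetCode (f γ)) :=
  inferInstanceAs (IsDelta S (fun γ => ∀ k < f γ, ¬ finSet k = finSet (f γ)))

theorem isSeqOfLength_iff {s l : M} : IsSeqOfLength s l ↔ IsFinSetCode s ∧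
    (∀ e ∈ finSet s, ∃ i < l, ∃ j < e + 1, e = pair i j) ∧
      ∀ i < l, ∃ j < s, pair i j ∈ finSet s ∧ ∀ j' < s, pair i j' ∈ finSet s → j' = j := by
  refine and_congr Iff.rfl (and_congr ?_ ?_)
  · refine forall₂_congr fun e _ => exists_congr fun i => ⟨?_, ?_⟩
    · rintro ⟨j, hi, rfl⟩
      exact ⟨hi, j, lt_add_one_iff'.2 (right_le_pair i j), rfl⟩
    · rintro ⟨hi, j, -, h⟩
      exact ⟨j, hi, h⟩
  · have key : ∀ i j, pair i j ∈ finSet s → j < s := fun i j h => IsEntry.lt ⟨i, h⟩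
    refine forall₂_congr fun i _ => exists_congr fun j => ⟨?_, ?_⟩
    · rintro ⟨h, h'⟩
      exact ⟨key i j h, h, fun j' _ => h' j'⟩
    · rintro ⟨-, h, h'⟩
      exact ⟨h, fun j' h'' => h' j' (key _ _ h'') h''⟩

instance isDelta_isSeqOfLength (f g : Γ → M) [IsRec S f] [IsRec S g] :
    IsDelta S (fun γ => IsSeqOfLength (f γ) (g γ)) :=
  IsDelta.congr (P := fun γ => IsFinSetCode (f γ) ∧
    (∀ e ∈ finSet (f γ), ∃ i < g γ, ∃ j < e + 1, e = pair i j) ∧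
      ∀ i < g γ, ∃ j < f γ, pair i j ∈ finSet (f γ) ∧
        ∀ j' < f γ, pair i j' ∈ finSet (f γ) → j' = j) inferInstance fun _ => isSeqOfLength_iff

include hS in
theorem isSeq_iff {s : M} : IsSeq s ↔ ∃ l < s + 1, IsSeqOfLength s l := by
  refine ⟨fun ⟨l, h⟩ => ⟨l, lt_add_one_iff'.2 ?_, h⟩, fun ⟨l, _, h⟩ => ⟨l, h⟩⟩
  rcases hS.out.zero_or_succ l with rfl | ⟨i, rfl⟩
  · exact zero_le
  · obtain ⟨j, hj, -⟩ := h.2.2 i (lt_add_one i)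
    exact IsDiscrete.add_one_le ((left_le_pair i j).trans_lt (lt_of_mem_finSet hj))

instance isDelta_isSeq (f : Γ → M) [IsRec S f] : IsDelta S (fun γ => IsSeq (f γ)) :=
  IsDelta.congr (P := fun γ => ∃ l < f γ + 1, IsSeqOfLength (f γ) l) inferInstance
    fun _ => isSeq_iff (S := S)

theorem isEntry_iff {b s : M} : IsEntry b s ↔ ∃ i < s, pair i b ∈ finSet s :=
  ⟨fun ⟨i, h⟩ => ⟨i, (left_le_pair i b).trans_lt (lt_of_mem_finSet h), h⟩, fun ⟨i, _, h⟩ => ⟨i, h⟩⟩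

instance isDelta_isEntry (f g : Γ → M) [IsRec S f] [IsRec S g] :
    IsDelta S (fun γ => IsEntry (f γ) (g γ)) :=
  IsDelta.congr (P := fun γ => ∃ i < g γ, pair i (f γ) ∈ finSet (g γ)) inferInstance
    fun _ => isEntry_iff

/-! ### Bounded comprehension for codes -/

/-- There is no subtraction, so the two quotients are compared; if the one for `b + c` is not
larger, then `c = 0`. -/
theorem dvd_of_dvd_add {a b c : M} (h : a ∣ b + c) (hb : a ∣ b) : a ∣ c := by
  obtain ⟨x, hx⟩ := h
  obtain ⟨y, rfl⟩ := hb
  rcases le_total x y with hxy | hxy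
  · have h1 : a * y + c ≤ a * y + 0 := by
      rw [hx, add_zero]
      exact mul_le_mul' le_rfl hxy
    rw [le_antisymm (le_of_add_le_add_left h1) zero_le]
    exact dvd_zero a
  · obtain ⟨w, rfl⟩ := exists_add_of_le hxy
    exact ⟨w, add_left_cancel (hx.trans (mul_add _ _ _))⟩

/-- Modulo `m * (i + 1) + 1` the number `m` is a unit, hence so is its divisor `d`, and both factors
cancel. -/
theorem dvd_of_dvd_mul_modulus {m i d n : M} (hd : d ∣ m) (h : m * (i + 1) + 1 ∣ n * (m * d)) :
    m * (i + 1) + 1 ∣ n := by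
  have h1 : m * (i + 1) + 1 ∣ n * d := by
    refine dvd_of_dvd_add (b := n * (m * d) * (i + 1)) ?_ (h.mul_right _)
    exact ⟨n * d, by ring⟩
  obtain ⟨k, rfl⟩ := hd
  refine dvd_of_dvd_add (b := n * d * (k * (i + 1))) ?_ (h1.mul_right _)
  exact ⟨n, by ring⟩

/-- The moduli for `i` and `j` differ by `m * d`, where `d` is the distance of `i` and `j` and thus
divides `m`. This replaces coprimality of distinct moduli. -/
theorem dvd_of_dvd_mul_of_ne {p m i j n : M} (hm : ∀ d < p + 1, 0 < d → d ∣ m) (hi : i < p)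
    (hj : j < p) (hij : i ≠ j) (h : m * (i + 1) + 1 ∣ n * (m * (j + 1) + 1)) :
    m * (i + 1) + 1 ∣ n := by
  rcases hij.lt_or_gt with hij | hij
  · obtain ⟨d, rfl⟩ := exists_add_of_le hij.le
    refine dvd_of_dvd_mul_modulus (d := d) (hm d ?_ ?_) ?_
    · exact (le_add_self.trans_lt hj).trans (lt_add_one p)
    · exact pos_of_lt_add_right hij
    · refine dvd_of_dvd_add (b := n * (m * (i + 1) + 1)) ?_ (dvd_mul_left _ _)
      convert h using 1
      ring
  · obtain ⟨d, rfl⟩ := exists_add_of_le hij.le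
    refine dvd_of_dvd_mul_modulus (d := d) (hm d ?_ ?_) ?_
    · exact (le_add_self.trans_lt hi).trans (lt_add_one p)
    · exact pos_of_lt_add_right hij
    · refine dvd_of_dvd_add ?_ h
      exact ⟨n, by ring⟩

include hS in
variable (S) in
-- A substitute for the factorial, which would need primitive recursion.
theorem exists_common_multiple (p : M) : ∃ m, 0 < m ∧ ∀ d < p + 1, 0 < d → d ∣ m := by
  refine induction_sigma (S := S) (P := fun p => ∃ m, 0 < m ∧ ∀ d < p + 1, 0 < d → d ∣ m)
    (IsSigma.ex (P := fun q : (Base S × M) × M => 0 < q.2 ∧ ∀ d < q.1.2 + 1, 0 < d → d ∣ q.2)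
      IsDelta.pos) ⟨1, zero_lt_one, fun d hd hd' => ?_⟩ (fun n ⟨m, hm, h⟩ => ?_) p
  · exact absurd hd' (not_lt.2 (lt_add_one_iff'.1 hd))
  · refine ⟨m * (n + 1), mul_pos hm (by positivity), fun d hd hd' => ?_⟩
    rcases (lt_add_one_iff'.1 hd).lt_or_eq with hd | rfl
    · exact (h d hd hd').mul_right _
    · exact dvd_mul_left _ _

theorem exists_code (U : Set M) [hU : Fact (U ∈ S)] (p : M) :
    ∃ k, ∀ i, i ∈ finSet k ↔ i < p ∧ i ∈ U := by
  obtain ⟨m, hm0, hm⟩ := exists_common_multiple S p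
  -- The number `n` is the product of the moduli `m * (i + 1) + 1` over `i ∈ U` below `q` and `p`,
  -- built one factor at a time.
  have key : ∀ q, ∃ n, ∀ i < p, m * (i + 1) + 1 ∣ n ↔ i < q ∧ i ∈ U := by
    refine induction_sigma (S := S) (IsSigma.ex (P := fun q : (Base S × M) × M =>
      ∀ i < p, m * (i + 1) + 1 ∣ q.2 ↔ i < q.1.2 ∧ i ∈ U) IsDelta.pos) ⟨1, fun i _ => ?_⟩
      fun q ⟨n, hn⟩ => ?_
    · refine ⟨?_, fun h => absurd h.1 (not_lt.2 zero_le)⟩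
      rintro ⟨c, hc⟩
      exfalso
      have h0 : 0 < c := by
        refine pos_of_ne_zero ?_
        rintro rfl
        simp at hc
      have : m * (i + 1) + 1 ≤ 0 + 1 := by
        rw [zero_add]
        exact (le_mul_of_one_le_right zero_le (one_le_of_pos h0)).trans_eq hc.symm
      exact absurd (le_of_add_le_add_right this) (not_le.2 (mul_pos hm0 (by positivity)))
    · by_cases hq : q < p ∧ q ∈ U
      · refine ⟨n * (m * (q + 1) + 1), fun i hi => ?_⟩
        by_cases hiq : i = q
        · subst hiq
          exact ⟨fun _ => ⟨lt_add_one i, hq.2⟩, fun _ => dvd_mul_left _ _⟩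
        · rw [lt_add_one_iff', Ne.le_iff_lt hiq, ← hn i hi]
          exact ⟨dvd_of_dvd_mul_of_ne hm hi hq.1 hiq, fun h => h.mul_right _⟩
      · refine ⟨n, fun i hi => ?_⟩
        rw [hn i hi, lt_add_one_iff']
        refine ⟨fun h => ⟨h.1.le, h.2⟩, fun h => ⟨h.1.lt_of_ne ?_, h.2⟩⟩
        rintro rfl
        exact hq ⟨hi, h.2⟩
  obtain ⟨n, hn⟩ := key p
  refine ⟨pair (pair p m) n, fun i => ⟨?_, fun h => ⟨p, m, n, rfl, h.1, (hn i h.1).2 h⟩⟩⟩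
  rintro ⟨p', m', n', h, hi, h'⟩
  rw [pair_inj, pair_inj] at h
  obtain ⟨⟨rfl, rfl⟩, rfl⟩ := h
  exact (hn i hi).1 h'

end Coding

/-! ### Primitive recursion and course-of-values recursion -/

section Recursion

variable {M : Type*} [CommSemiring M] [LinearOrder M] [IsStrictOrderedRing M]
  [CanonicallyOrderedAdd M] [IsDiscrete M] {S : Set (Set M)} [hS : Fact (IsModelRCA0 S)]
  {Γ : Type*} [Ctx S Γ]

variable (S) in
/-- The graph of the function `φ` belongs to the second-order part of the model. -/
class IsFun (φ : M → M) : Prop where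
  graph : {z | ∃ x, z = pair x (φ x)} ∈ S

theorem IsRec.isFun {f : Γ → M → M} (hf : IsRec S (fun p : Γ × M => f p.1 p.2)) (γ : Γ) :
    IsFun S (f γ) := by
  have : IsRec S (fun p : ((Γ × M) × M) => f p.1.1 p.2) := hf.comp isRen_fst.lift
  have h : IsDelta S (fun p : Γ × M => ∃ x < p.2 + 1, p.2 = pair x (f p.1 x)) := inferInstance
  refine ⟨?_⟩
  convert IsDelta.setOf_mem (P := fun γ z => ∃ x < z + 1, z = pair x (f γ x)) h γ using 3 with z
  exact ⟨fun ⟨x, h⟩ => ⟨x, by rw [h]; exact lt_add_one_iff'.2 (left_le_pair _ _), h⟩,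
    fun ⟨x, _, h⟩ => ⟨x, h⟩⟩

instance isRec_isFun (φ : M → M) (f : Γ → M) [hφ : IsFun S φ] [IsRec S f] :
    IsRec S (fun γ => φ (f γ)) := by
  have : Fact ({z | ∃ x, z = pair x (φ x)} ∈ S) := ⟨hφ.graph⟩
  have : IsDelta S (fun p : Γ × M => pair (f p.1) p.2 ∈ {z | ∃ x, z = pair x (φ x)}) :=
    inferInstance
  refine ⟨this.pos.congr fun p => ?_⟩
  constructor
  · exact fun h => ⟨f p.1, by rw [h]⟩
  · rintro ⟨x, h⟩
    rw [pair_inj] at h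
    rw [h.1, h.2]

theorem IsSigma.exists_isRec {P : Γ → M → Prop} (hP : IsSigma S (fun p : Γ × M => P p.1 p.2))
    (h : ∀ γ, ∃! x, P γ x) : ∃ f : Γ → M, IsRec S f ∧ ∀ γ, P γ (f γ) := by
  choose f hf hf' using h
  exact ⟨f, ⟨hP.congr fun p => ⟨fun h => h ▸ hf p.1, fun h => (hf' _ _ h).symm⟩⟩, hf⟩

/-- Choosing the least solution makes the graph `Δ⁰₁`. -/
theorem IsDelta.exists_isRec {P : Γ → M → Prop} (hP : IsDelta S (fun p : Γ × M => P p.1 p.2))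
    (h : ∀ γ, ∃ x, P γ x) : ∃ f : Γ → M, IsRec S f ∧ ∀ γ, P γ (f γ) := by
  have : IsDelta S (fun p : (Γ × M) × M => P p.1.1 p.2) := hP.comp isRen_fst.lift
  have hD : IsDelta S (fun p : Γ × M => P p.1 p.2 ∧ ∀ y < p.2, ¬ P p.1 y) := inferInstance
  obtain ⟨f, hf, hf'⟩ := IsSigma.exists_isRec (P := fun γ x => P γ x ∧ ∀ y < x, ¬ P γ y) hD.pos
    fun γ => by
      obtain ⟨a, ha⟩ := h γ
      obtain ⟨x, hx, hx'⟩ := hP.pos.exists_least ha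
      exact ⟨x, ⟨hx, hx'⟩, fun y hy => le_antisymm (not_lt.1 fun h => hy.2 x h hx)
        (not_lt.1 fun h => hx' y h hy.1)⟩
  exact ⟨f, hf, fun γ => (hf' γ).1⟩

variable (S) in
include hS in
theorem exists_code_empty : ∃ c : M, ∀ i, i ∉ finSet c := by
  have : Fact (hS.out.sets_nonempty.some ∈ S) := ⟨hS.out.sets_nonempty.some_mem⟩
  obtain ⟨c, hc⟩ := exists_code (S := S) hS.out.sets_nonempty.some 0
  exact ⟨c, fun i hi => absurd ((hc i).1 hi).1 (not_lt.2 zero_le)⟩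

variable (S) in
include hS in
theorem exists_adjoin (c e : M) : ∃ k, ∀ i, i ∈ finSet k ↔ i ∈ finSet c ∨ i = e := by
  have : Fact ({i | i ∈ finSet c ∨ i = e} ∈ S) := ⟨setOf_mem_delta inferInstance⟩
  obtain ⟨k, hk⟩ := exists_code (S := S) {i | i ∈ finSet c ∨ i = e} (c + e + 1)
  refine ⟨k, fun i => (hk i).trans ⟨fun h => h.2, fun h => ⟨?_, h⟩⟩⟩
  rw [lt_add_one_iff']
  rcases h with h | rfl
  · exact (lt_of_mem_finSet h).le.trans le_self_add
  · exact le_add_self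

/-- Every element of the finite set with code `c` is justified by the clauses of the recursion
`h(0) = a` and `h(n + 1) = g(n, h(n))`. -/
def IsRecursionSet (a : M) (g : M → M → M) (c : M) : Prop :=
  ∀ z ∈ finSet c, z = pair 0 a ∨
    ∃ i < c, ∃ y < c, pair i y ∈ finSet c ∧ z = pair (i + 1) (g i y)

include hS in
theorem IsRecursionSet.exists_adjoin {a c e : M} {g : M → M → M} (hc : IsRecursionSet a g c)
    (he : e = pair 0 a ∨ ∃ i y, pair i y ∈ finSet c ∧ e = pair (i + 1) (g i y)) :
    ∃ k, IsRecursionSet a g k ∧ e ∈ finSet k := by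
  obtain ⟨k, hk⟩ := SOA.exists_adjoin S c e
  refine ⟨k, fun z hz => ?_, (hk e).2 (Or.inr rfl)⟩
  have lift : ∀ i y, pair i y ∈ finSet c → i < k ∧ y < k ∧ pair i y ∈ finSet k := fun i y h => by
    have h' := (hk _).2 (Or.inl h)
    exact ⟨(left_le_pair i y).trans_lt (lt_of_mem_finSet h'), IsEntry.lt ⟨i, h'⟩, h'⟩
  rcases (hk z).1 hz with hz | rfl
  · refine (hc z hz).imp_right fun ⟨i, _, y, _, h, h'⟩ => ?_
    obtain ⟨h1, h2, h3⟩ := lift i y h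
    exact ⟨i, h1, y, h2, h3, h'⟩
  · refine he.imp_right fun ⟨i, y, h, h'⟩ => ?_
    obtain ⟨h1, h2, h3⟩ := lift i y h
    exact ⟨i, h1, y, h2, h3, h'⟩

include hS in
-- Any two justified finite sets agree, so "some justified set contains the pair" is a `Σ⁰₁`
-- definition of a function.
theorem IsRecursionSet.unique {a c c' : M} {g : M → M → M} (hc : IsRecursionSet a g c)
    (hc' : IsRecursionSet a g c') (n : M) : ∀ y < c, ∀ y' < c', pair n y ∈ finSet c →
      pair n y' ∈ finSet c' → y = y' := by
  have h0 : ∀ i : M, (0 : M) ≠ i + 1 := fun i h => hS.out.succ_ne_zero i h.symm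
  refine induction_delta (S := S) (P := fun n => ∀ y < c, ∀ y' < c', pair n y ∈ finSet c →
      pair n y' ∈ finSet c' → y = y') inferInstance ?_ (fun n ih => ?_) n
  · intro y _ y' _ h h'
    rcases hc _ h with h | ⟨i, -, z, -, -, h⟩
    · rcases hc' _ h' with h' | ⟨i, -, z, -, -, h'⟩
      · exact (pair_inj.1 h).2.trans (pair_inj.1 h').2.symm
      · exact absurd (pair_inj.1 h').1 (h0 i)
    · exact absurd (pair_inj.1 h).1 (h0 i)
  · intro y _ y' _ h h'
    rcases hc _ h with h | ⟨i, -, z, hz, hi, h⟩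
    · exact absurd (pair_inj.1 h).1.symm (h0 n)
    rcases hc' _ h' with h' | ⟨i', -, z', hz', hi', h'⟩
    · exact absurd (pair_inj.1 h').1.symm (h0 n)
    rw [pair_inj] at h h'
    obtain rfl := add_right_cancel h.1
    obtain rfl := add_right_cancel h'.1
    rw [h.2, h'.2, ih z hz z' hz' hi hi']

/-- Primitive recursion. -/
theorem exists_primRec (a : Γ → M) (g : Γ → M → M → M) [ha : IsRec S a]
    [hg : IsRec S (fun p : (Γ × M) × M => g p.1.1 p.1.2 p.2)] :
    ∃ h : Γ → M → M, IsRec S (fun p : Γ × M => h p.1 p.2) ∧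
      ∀ γ, h γ 0 = a γ ∧ ∀ n, h γ (n + 1) = g γ n (h γ n) := by
  have hJ : IsDelta S (fun p : Γ × M => IsRecursionSet (a p.1) (g p.1) p.2) := by
    have : IsRec S (fun p : (((Γ × M) × M) × M) × M => g p.1.1.1.1 p.1.2 p.2) :=
      hg.comp isRen_fst.weak.lift.lift
    exact inferInstanceAs (IsDelta S (fun p : Γ × M => ∀ z ∈ finSet p.2, z = pair 0 (a p.1) ∨
      ∃ i < p.2, ∃ y < p.2, pair i y ∈ finSet p.2 ∧ z = pair (i + 1) (g p.1 i y)))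
  have hex : ∀ γ n, ∃ c, IsRecursionSet (a γ) (g γ) c ∧ ∃ y < c, pair n y ∈ finSet c := by
    intro γ
    have : IsDelta S (fun p : (Γ × M) × M => IsRecursionSet (a p.1.1) (g p.1.1) p.2) :=
      hJ.comp isRen_fst.lift
    refine IsSigma.induction (P := fun γ n => ∃ c, IsRecursionSet (a γ) (g γ) c ∧
      ∃ y < c, pair n y ∈ finSet c) (IsSigma.ex (S := S) (P := fun q : (Γ × M) × M =>
      IsRecursionSet (a q.1.1) (g q.1.1) q.2 ∧ ∃ y < q.2, pair q.1.2 y ∈ finSet q.2) IsDelta.pos)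
      ?_ fun n ⟨c, hc, y, _, hy⟩ => ?_
    · obtain ⟨c, hc⟩ := exists_code_empty S
      obtain ⟨k, hk, hk'⟩ := IsRecursionSet.exists_adjoin (S := S) (a := a γ) (g := g γ)
        (fun z hz => absurd hz (hc z)) (Or.inl rfl)
      exact ⟨k, hk, _, IsEntry.lt ⟨_, hk'⟩, hk'⟩
    · obtain ⟨k, hk, hk'⟩ := IsRecursionSet.exists_adjoin (S := S) hc (Or.inr ⟨n, y, hy, rfl⟩)
      exact ⟨k, hk, _, IsEntry.lt ⟨_, hk'⟩, hk'⟩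
  have hJ2 : IsDelta S (fun p : ((Γ × M) × M) × M => IsRecursionSet (a p.1.1.1) (g p.1.1.1) p.2) :=
    hJ.comp isRen_fst.weak.lift
  obtain ⟨h, hh, hh'⟩ := IsSigma.exists_isRec (Γ := Γ × M)
    (P := fun p y => ∃ c, IsRecursionSet (a p.1) (g p.1) c ∧ pair p.2 y ∈ finSet c)
    (IsSigma.ex (S := S) (P := fun q : ((Γ × M) × M) × M =>
      IsRecursionSet (a q.1.1.1) (g q.1.1.1) q.2 ∧ pair q.1.1.2 q.1.2 ∈ finSet q.2) IsDelta.pos)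
    fun p => by
      obtain ⟨c, hc, y, hy, hy'⟩ := hex p.1 p.2
      refine ⟨y, ⟨c, hc, hy'⟩, fun z ⟨c', hc', hz⟩ => ?_⟩
      exact IsRecursionSet.unique (S := S) hc' hc p.2 z (IsEntry.lt ⟨_, hz⟩) y hy hz hy'
  refine ⟨fun γ n => h (γ, n), hh, fun γ => ⟨?_, fun n => ?_⟩⟩
  · obtain ⟨c, hc⟩ := exists_code_empty S
    obtain ⟨k, hk, hk'⟩ := IsRecursionSet.exists_adjoin (S := S) (a := a γ) (g := g γ)
      (fun z hz => absurd hz (hc z)) (Or.inl rfl)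
    obtain ⟨c', hc', h'⟩ := hh' (γ, 0)
    exact IsRecursionSet.unique (S := S) hc' hk 0 _ (IsEntry.lt ⟨_, h'⟩) _ (IsEntry.lt ⟨_, hk'⟩) h' hk'
  · obtain ⟨c, hc, hy⟩ := hh' (γ, n)
    obtain ⟨k, hk, hk'⟩ := IsRecursionSet.exists_adjoin (S := S) hc (Or.inr ⟨n, _, hy, rfl⟩)
    obtain ⟨c', hc', h'⟩ := hh' (γ, n + 1)
    exact IsRecursionSet.unique (S := S) hc' hk _ _ (IsEntry.lt ⟨_, h'⟩) _ (IsEntry.lt ⟨_, hk'⟩) h' hk'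

/-- Course-of-values recursion. -/
theorem exists_courseOfValues (G : Γ → M → M → M)
    [hG : IsRec S (fun p : (Γ × M) × M => G p.1.1 p.1.2 p.2)] :
    ∃ f : Γ → M → M, IsRec S (fun p : Γ × M => f p.1 p.2) ∧
      ∀ γ x, ∃ c, (∀ i y, pair i y ∈ finSet c ↔ i < x ∧ y = f γ i) ∧ f γ x = G γ x c := by
  have : IsDelta S (fun p : ((Γ × M) × M) × M =>
      (∀ i ∈ finSet p.1.2, i ∈ finSet p.2) ∧ pair p.1.1.2 (G p.1.1.1 p.1.1.2 p.1.2) ∈ finSet p.2 ∧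
        ∀ i ∈ finSet p.2, i ∈ finSet p.1.2 ∨ i = pair p.1.1.2 (G p.1.1.1 p.1.1.2 p.1.2)) := by
    have : IsRec S (fun p : ((Γ × M) × M) × M => G p.1.1.1 p.1.1.2 p.1.2) := hG.comp isRen_fst
    have : IsRec S (fun p : (((Γ × M) × M) × M) × M => G p.1.1.1.1 p.1.1.1.2 p.1.1.2) :=
      hG.comp isRen_fst.weak
    infer_instance
  -- The function `s` extends a history `c` of values below `x` by the value `G(x, c)` at `x`; the
  -- histories then arise by primitive recursion.
  obtain ⟨s, hs, hs'⟩ := IsDelta.exists_isRec (Γ := (Γ × M) × M) (P := fun p k =>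
      (∀ i ∈ finSet p.2, i ∈ finSet k) ∧ pair p.1.2 (G p.1.1 p.1.2 p.2) ∈ finSet k ∧
        ∀ i ∈ finSet k, i ∈ finSet p.2 ∨ i = pair p.1.2 (G p.1.1 p.1.2 p.2)) this fun p => by
    obtain ⟨k, hk⟩ := exists_adjoin S p.2 (pair p.1.2 (G p.1.1 p.1.2 p.2))
    exact ⟨k, fun i hi => (hk i).2 (Or.inl hi), (hk _).2 (Or.inr rfl), fun i hi => (hk i).1 hi⟩
  obtain ⟨e, he⟩ := exists_code_empty S
  obtain ⟨h, hh, hh'⟩ := exists_primRec (S := S) (fun _ : Γ => e) (fun γ x c => s ((γ, x), c))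
  have hf : IsRec S (fun p : Γ × M => G p.1 p.2 (h p.1 p.2)) := hG.subst (fun p : Γ × M => h p.1 p.2)
  refine ⟨fun γ x => G γ x (h γ x), hf, fun γ x => ⟨h γ x, ?_, rfl⟩⟩
  have : IsFun S (h γ) := IsRec.isFun hh γ
  have : IsFun S (fun x => G γ x (h γ x)) :=
    IsRec.isFun (f := fun γ x => G γ x (h γ x)) hf γ
  set f := fun x => G γ x (h γ x) with hfdef
  have key : (∀ z ∈ finSet (h γ x), ∃ i < x, z = pair i (f i)) ∧
      ∀ i < x, pair i (f i) ∈ finSet (h γ x) := by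
    refine induction_delta (S := S) (P := fun x => (∀ z ∈ finSet (h γ x), ∃ i < x, z = pair i (f i)) ∧
      ∀ i < x, pair i (f i) ∈ finSet (h γ x)) inferInstance ?_ (fun n ⟨ih, ih'⟩ => ?_) x
    · rw [(hh' γ).1]
      exact ⟨fun z hz => absurd hz (he z), fun i hi => absurd hi (not_lt.2 zero_le)⟩
    · rw [(hh' γ).2 n]
      obtain ⟨h1, h2, h3⟩ := hs' ((γ, n), h γ n)
      refine ⟨fun z hz => ?_, fun i hi => ?_⟩
      · rcases h3 z hz with hz | rfl
        · obtain ⟨i, hi, hi'⟩ := ih z hz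
          exact ⟨i, hi.trans (lt_add_one n), hi'⟩
        · exact ⟨n, lt_add_one n, rfl⟩
      · rcases (lt_add_one_iff'.1 hi).lt_or_eq with hi | rfl
        · exact h1 _ (ih' i hi)
        · exact h2
  intro i y
  constructor
  · intro hi
    obtain ⟨j, hj, e⟩ := key.1 _ hi
    rw [pair_inj] at e
    rw [e.1, e.2]
    exact ⟨hj, rfl⟩
  · rintro ⟨hi, rfl⟩
    exact key.2 i hi

/-- Recursive definition of a set. -/
theorem exists_recursive_set (Φ : M → M → Prop)
    [hΦ : IsDelta S (fun p : (Base S × M) × M => Φ p.1.2 p.2)] :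
    ∃ T ∈ S, ∀ x, ∃ c, (∀ i, pair i 1 ∈ finSet c ↔ i < x ∧ i ∈ T) ∧ (x ∈ T ↔ Φ x c) := by
  classical
  let γ : Base S := ⟨hS.out.sets_nonempty.some, hS.out.sets_nonempty.some_mem, trivial⟩
  have : IsRec S (fun p : (Base S × M) × M => if Φ p.1.2 p.2 then (1 : M) else 0) := by
    convert isRec_ite (S := S) (fun p : (Base S × M) × M => Φ p.1.2 p.2) (fun _ => 1) (fun _ => 0)
  -- The recursion computes the characteristic function, so `pair i 1` lies in the history exactly
  -- for earlier elements `i` of the set.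
  obtain ⟨f, hf, hf'⟩ := exists_courseOfValues (S := S)
    (fun (_ : Base S) x c => if Φ x c then (1 : M) else 0)
  have := IsRec.isFun hf γ
  refine ⟨{x | f γ x = 1}, setOf_mem_delta inferInstance, fun x => ?_⟩
  obtain ⟨c, hc, hx⟩ := hf' γ x
  refine ⟨c, fun i => (hc i 1).trans (and_congr Iff.rfl eq_comm), ?_⟩
  change f γ x = 1 ↔ _
  rw [hx]
  split_ifs with h <;> simp [h]

/-! ### Projections -/

/-- The first component of a pair. -/
noncomputable def fst (z : M) : M := bmin (z + 1) (fun m => ∃ n < z + 1, z = pair m n)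

/-- The second component of a pair. -/
noncomputable def snd (z : M) : M := bmin (z + 1) (fun n => ∃ m < z + 1, z = pair m n)

@[simp] theorem fst_pair (m n : M) : fst (pair m n) = m :=
  bmin_eq_of_unique ⟨n, lt_add_one_iff'.2 (right_le_pair m n), rfl⟩
    (lt_add_one_iff'.2 (left_le_pair m n)) fun _ ⟨_, _, h⟩ => (pair_inj.1 h).1.symm

@[simp] theorem snd_pair (m n : M) : snd (pair m n) = n :=
  bmin_eq_of_unique ⟨m, lt_add_one_iff'.2 (left_le_pair m n), rfl⟩
    (lt_add_one_iff'.2 (right_le_pair m n)) fun _ ⟨_, _, h⟩ => (pair_inj.1 h).2.symm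

instance isRec_fst (f : Γ → M) [IsRec S f] : IsRec S (fun γ => fst (f γ)) :=
  isRec_bmin (fun γ => f γ + 1) (fun γ m => ∃ n < f γ + 1, f γ = pair m n)

instance isRec_snd (f : Γ → M) [IsRec S f] : IsRec S (fun γ => snd (f γ)) :=
  isRec_bmin (fun γ => f γ + 1) (fun γ n => ∃ m < f γ + 1, f γ = pair m n)

end Recursion

section Trees

variable {M : Type*} [CommSemiring M] [LinearOrder M] [IsStrictOrderedRing M]
  [CanonicallyOrderedAdd M] [IsDiscrete M] {S : Set (Set M)} [hS : Fact (IsModelRCA0 S)]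

/-! ### The set of trees and the weak order -/

include hS in
theorem exists_isTreeSet {Q : Set M} (hQ : Q ∈ S) : ∃ T ∈ S, IsTreeSet Q T := by
  have : Fact (Q ∈ S) := ⟨hQ⟩
  obtain ⟨T, hT, h⟩ := exists_recursive_set (S := S) (fun x c => fst x ∈ Q ∧
    x = pair (fst x) (snd x) ∧ IsSeq (snd x) ∧
      ∀ b < snd x, IsEntry b (snd x) → pair b 1 ∈ finSet c)
  refine ⟨T, hT, fun x => ?_⟩
  obtain ⟨c, hc, hx⟩ := h x
  rw [hx]
  constructor
  · rintro ⟨h1, h2, h3, h4⟩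
    exact ⟨_, h1, _, h2, h3, fun b hb => ((hc b).1 (h4 b hb.lt hb)).2⟩
  · rintro ⟨q, hq, s, rfl, hs, hb⟩
    simp only [fst_pair, snd_pair]
    exact ⟨hq, trivial, hs, fun b hbs hb' => (hc b).2 ⟨hbs.trans_le (right_le_pair q s), hb b hb'⟩⟩

include hS in
-- The recursion runs along codes of pairs of trees: `pair` is strictly increasing in each argument,
-- and each clause passes to an entry on one side.
theorem exists_isWeakOrder {R T : Set M} (hR : R ∈ S) (hT : T ∈ S) :
    ∃ L ∈ S, IsWeakOrder R T L := by
  have : Fact (R ∈ S) := ⟨hR⟩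
  have : Fact (T ∈ S) := ⟨hT⟩
  obtain ⟨L, hL, h⟩ := exists_recursive_set (S := S) (fun z c => z = pair (fst z) (snd z) ∧
    fst z ∈ T ∧ snd z ∈ T ∧ ((pair (fst (fst z)) (fst (snd z)) ∈ R ∧
      ∀ a < snd (fst z), IsEntry a (snd (fst z)) → pair (pair a (snd z)) 1 ∈ finSet c) ∨
      ∃ b < snd (snd z), IsEntry b (snd (snd z)) ∧ pair (pair (fst z) b) 1 ∈ finSet c))
  refine ⟨L, hL, fun z hz => ?_, fun p s q t hx hy => ?_⟩
  · obtain ⟨c, -, hz'⟩ := h z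
    obtain ⟨h1, h2, h3, -⟩ := hz'.1 hz
    exact ⟨_, h2, _, h3, h1⟩
  · obtain ⟨c, hc, hz⟩ := h (pair (pair p s) (pair q t))
    rw [hz]
    simp only [fst_pair, snd_pair, hx, hy, true_and, hc]
    have h1 : ∀ a, IsEntry a s → pair a (pair q t) < pair (pair p s) (pair q t) := fun a ha =>
      pair_lt_pair_left _ (ha.lt.trans_le (right_le_pair p s))
    have h2 : ∀ b, IsEntry b t → pair (pair p s) b < pair (pair p s) (pair q t) := fun b hb =>
      pair_lt_pair_right _ (hb.lt.trans_le (right_le_pair q t))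
    refine or_congr (and_congr Iff.rfl ?_) ?_
    · exact ⟨fun h a ha => (h a ha.lt ha).2, fun h a _ ha => ⟨h1 a ha, h a ha⟩⟩
    · exact ⟨fun ⟨b, _, hb, _, h⟩ => ⟨b, hb, h⟩, fun ⟨b, hb, h⟩ => ⟨b, hb.lt, hb, h2 b hb, h⟩⟩

theorem IsTreeSet.exists_pair {Q T : Set M} {x : M} (hT : IsTreeSet Q T) (hx : x ∈ T) :
    ∃ q ∈ Q, ∃ s, x = pair q s ∧ ∀ b, IsEntry b s → b ∈ T ∧ b < x := by
  obtain ⟨q, hq, s, rfl, -, h⟩ := (hT x).1 hx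
  exact ⟨q, hq, s, rfl, fun b hb => ⟨h b hb, hb.lt.trans_le (right_le_pair q s)⟩⟩

theorem IsWeakOrder.of_entry {R T L : Set M} (hL : IsWeakOrder R T L) {p s q t b : M}
    (hx : pair p s ∈ T) (hy : pair q t ∈ T) (hb : IsEntry b t) (h : pair (pair p s) b ∈ L) :
    pair (pair p s) (pair q t) ∈ L := (hL.2 p s q t hx hy).2 (Or.inr ⟨b, hb, h⟩)

theorem IsWeakOrder.mem {R T L : Set M} (hL : IsWeakOrder R T L) {x y : M} (h : pair x y ∈ L) :
    x ∈ T ∧ y ∈ T := by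
  obtain ⟨x', hx, y', hy, e⟩ := hL.1 _ h
  rw [pair_inj] at e
  rw [e.1, e.2]
  exact ⟨hx, hy⟩

theorem IsWeakOrder.isQuasiOrder {Q R T L : Set M} (hQ : IsQuasiOrder S Q R) (hTS : T ∈ S)
    (hLS : L ∈ S) (hT : IsTreeSet Q T) (hL : IsWeakOrder R T L) : IsQuasiOrder S T L := by
  have : Fact (T ∈ S) := ⟨hTS⟩
  have : Fact (L ∈ S) := ⟨hLS⟩
  refine ⟨hTS, hLS, hL.1, fun x => ?_, fun a _ b _ c _ => ?_⟩
  · refine strong_induction_delta (S := S) (P := fun x => x ∈ T → pair x x ∈ L) inferInstance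
      (fun x ih hx => ?_) x
    obtain ⟨q, hq, s, rfl, hs⟩ := hT.exists_pair hx
    refine (hL.2 q s q s hx hx).2 (Or.inl ⟨hQ.refl q hq, fun a ha => ?_⟩)
    obtain ⟨haT, hax⟩ := hs a ha
    obtain ⟨q', -, s', rfl, -⟩ := hT.exists_pair haT
    exact hL.of_entry haT hx ha (ih _ hax haT)
  -- Transitivity goes by induction on the sum of the three codes, as each case passes to a subtree
  -- of just one tree. The bounds keep the statement `Δ⁰₁`.
  · have key : ∀ n, ∀ a < n + 1, ∀ b < n + 1, ∀ c < n + 1, a + b + c = n → pair a b ∈ L →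
        pair b c ∈ L → pair a c ∈ L := by
      refine strong_induction_delta (S := S) inferInstance fun n ih => ?_
      have ih' : ∀ a b c, a + b + c < n → pair a b ∈ L → pair b c ∈ L → pair a c ∈ L := by
        intro a b c h
        refine ih _ h a ?_ b ?_ c ?_ rfl <;> rw [lt_add_one_iff']
        · exact le_self_add.trans le_self_add
        · exact le_add_self.trans le_self_add
        · exact le_add_self
      intro a _ b _ c _ hn hab hbc
      obtain ⟨ha, hb⟩ := hL.mem hab
      obtain ⟨-, hc⟩ := hL.mem hbc
      obtain ⟨p, hp, s, rfl, hs⟩ := hT.exists_pair ha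
      obtain ⟨q, hq, t, rfl, ht⟩ := hT.exists_pair hb
      obtain ⟨r, hr, u, rfl, hu⟩ := hT.exists_pair hc
      rcases (hL.2 _ _ _ _ hb hc).1 hbc with ⟨hqr, hbc'⟩ | ⟨c', hc', h⟩
      · rcases (hL.2 _ _ _ _ ha hb).1 hab with ⟨hpq, hab'⟩ | ⟨b', hb', h⟩
        · refine (hL.2 _ _ _ _ ha hc).2 (Or.inl ⟨hQ.trans p hp q hq r hr hpq hqr, fun a' ha' => ?_⟩)
          refine ih' a' _ _ ?_ (hab' a' ha') hbc
          rw [← hn]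
          exact add_lt_add_left (add_lt_add_left (hs a' ha').2 _) _
        · refine ih' _ b' _ ?_ h (hbc' b' hb')
          rw [← hn]
          exact add_lt_add_left (add_lt_add_right (ht b' hb').2 _) _
      · refine hL.of_entry ha hc hc' (ih' _ _ c' ?_ hab h)
        rw [← hn]
        exact add_lt_add_right (hu c' hc').2 _
    refine key (a + b + c) a ?_ b ?_ c ?_ rfl <;> rw [lt_add_one_iff']
    · exact le_self_add.trans le_self_add
    · exact le_add_self.trans le_self_add
    · exact le_add_self

end Trees

section Arrays

variable {M : Type*} [CommSemiring M] [LinearOrder M] [IsStrictOrderedRing M]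
  [CanonicallyOrderedAdd M] [IsDiscrete M] {S : Set (Set M)} [hS : Fact (IsModelRCA0 S)]

/-! ### Enumerations -/

include hS in
variable (S) in
theorem strictMono_of_lt_succ {h : M → M} [IsFun S h] (hs : ∀ n, h n < h (n + 1)) : StrictMono h := by
  intro m n hmn
  refine induction_delta (S := S) (P := fun n => m < n → h m < h n) inferInstance
    (fun h => absurd h (not_lt.2 zero_le)) (fun n ih hn => ?_) n hmn
  rcases (lt_add_one_iff'.1 hn).lt_or_eq with hn | rfl
  · exact (ih hn).trans (hs n)
  · exact hs m

/-- The base is only `Σ⁰₁` and need not be shown to belong to `S`. A strictly increasing recursive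
sequence in it suffices, and `n ≤ e n` makes images under `e` `Δ⁰₁`. -/
theorem exists_enumeration_base {B : Set M} (hB : B ∈ S) (h : Unbounded (base B)) :
    ∃ e : M → M, IsFun S e ∧ StrictMono e ∧ (∀ n, e n ∈ base B) ∧ ∀ n, n ≤ e n := by
  have : Fact (B ∈ S) := ⟨hB⟩
  let γ : Base S := ⟨hS.out.sets_nonempty.some, hS.out.sets_nonempty.some_mem, trivial⟩
  obtain ⟨t, ht, ht'⟩ := IsDelta.exists_isRec (S := S) (Γ := Base S × M)
    (P := fun p w => fst w ∈ B ∧ snd w ∈ finSet (fst w) ∧ p.2 < snd w) inferInstance fun p => by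
      obtain ⟨n, ⟨s, hs, hn⟩, hpn⟩ := h p.2
      exact ⟨pair s n, by simp [hs, hn, hpn]⟩
  have : IsRec S (fun p : (Base S × M) × M => snd (t (p.1.1, p.2))) := by
    have : IsRec S (fun p : (Base S × M) × M => t (p.1.1, p.2)) := ht.comp isRen_fst.lift
    infer_instance
  obtain ⟨e, he, he'⟩ := exists_primRec (S := S) (fun _ : Base S => snd (t (γ, 0)))
    (fun γ _ y => snd (t (γ, y)))
  have := IsRec.isFun he γ
  have hs : ∀ n, e γ n < e γ (n + 1) := fun n => by
    rw [(he' γ).2]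
    exact (ht' (γ, e γ n)).2.2
  refine ⟨e γ, inferInstance, strictMono_of_lt_succ S hs, fun n => ?_, fun n => ?_⟩
  · rcases hS.out.zero_or_succ n with rfl | ⟨n, rfl⟩
    · rw [(he' γ).1]
      exact ⟨_, (ht' (γ, 0)).1, (ht' (γ, 0)).2.1⟩
    · rw [(he' γ).2]
      exact ⟨_, (ht' (γ, e γ n)).1, (ht' (γ, e γ n)).2.1⟩
  · refine induction_delta (S := S) (P := fun n => n ≤ e γ n) inferInstance zero_le
      (fun n ih => ?_) n
    exact IsDiscrete.add_one_le (ih.trans_lt (hs n))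

/-- The context that consists of an infinite set. -/
abbrev Inf (S : Set (Set M)) : Type _ := {X : Set M // X ∈ S ∧ Unbounded X}

/-- The function `x` lists the elements of the infinite set `X` in increasing order. -/
structure IsEnumeration (X : Set M) (x : M → M) : Prop where
  mem : ∀ k, x k ∈ X
  zero_le : ∀ y ∈ X, x 0 ≤ y
  lt : ∀ k, x k < x (k + 1)
  succ_le : ∀ k, ∀ y ∈ X, x k < y → x (k + 1) ≤ y

variable (S) in
include hS in
-- Uniformity in `X` matters: the final function must be defined by one formula with `X` as a set
-- variable.
theorem exists_isEnumeration : ∃ x : Inf S → M → M, IsRec S (fun p : Inf S × M => x p.1 p.2) ∧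
    ∀ X, IsEnumeration X.1 (x X) := by
  obtain ⟨a, ha, ha'⟩ := IsDelta.exists_isRec (S := S) (Γ := Inf S)
    (P := fun X z => z ∈ Ctx.param S X ∧ ∀ w < z, ¬ w ∈ Ctx.param S X)
    (inferInstanceAs (IsDelta S fun p : Inf S × M => p.2 ∈ Ctx.param S p ∧
      ∀ w < p.2, ¬ w ∈ Ctx.param S (p, w))) fun X => by
      obtain ⟨n, hn, -⟩ := X.2.2 0
      have : Fact (X.1 ∈ S) := ⟨X.2.1⟩
      exact exists_least_sigma (S := S) (P := fun z => z ∈ X.1) IsDelta.pos hn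
  obtain ⟨t, ht, ht'⟩ := IsDelta.exists_isRec (S := S) (Γ := Inf S × M)
    (P := fun p z => (z ∈ Ctx.param S p ∧ p.2 < z) ∧ ∀ w < z, ¬ (w ∈ Ctx.param S p ∧ p.2 < w))
    (inferInstanceAs (IsDelta S fun p : (Inf S × M) × M => (p.2 ∈ Ctx.param S p ∧ p.1.2 < p.2) ∧
      ∀ w < p.2, ¬ (w ∈ Ctx.param S (p, w) ∧ p.1.2 < w))) fun p => by
      obtain ⟨n, hn⟩ := p.1.2.2 p.2
      have : Fact (p.1.1 ∈ S) := ⟨p.1.2.1⟩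
      exact exists_least_sigma (S := S) (P := fun z => z ∈ p.1.1 ∧ p.2 < z) IsDelta.pos hn
  have : IsRec S (fun p : (Inf S × M) × M => t (p.1.1, p.2)) := ht.comp isRen_fst.lift
  obtain ⟨x, hx, hx'⟩ := exists_primRec (S := S) a (fun X _ y => t (X, y))
  refine ⟨x, hx, fun X => ⟨fun k => ?_, fun y hy => ?_, fun k => ?_, fun k y hy hk => ?_⟩⟩
  · rcases hS.out.zero_or_succ k with rfl | ⟨k, rfl⟩
    · rw [(hx' X).1]
      exact (ha' X).1
    · rw [(hx' X).2]
      exact (ht' (X, x X k)).1.1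
  · rw [(hx' X).1]
    exact not_lt.1 fun h => (ha' X).2 y h hy
  · rw [(hx' X).2]
    exact (ht' (X, x X k)).1.2
  · rw [(hx' X).2]
    exact not_lt.1 fun h => (ht' (X, x X k)).2 y h ⟨hy, hk⟩

theorem tail_mem {X : Set M} (hX : X ∈ S) : tail X ∈ S := by
  have : Fact (X ∈ S) := ⟨hX⟩
  have := setOf_mem_delta (S := S) (P := fun x => x ∈ X ∧ ∃ y < x, y ∈ X) inferInstance
  convert this using 1
  ext x
  exact and_congr Iff.rfl ⟨fun ⟨y, hy, h⟩ => ⟨y, h, hy⟩, fun ⟨y, hy, h⟩ => ⟨y, h, hy⟩⟩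

theorem Unbounded.tail {X : Set M} (hX : Unbounded X) : Unbounded (tail X) := fun n => by
  obtain ⟨m, hm, hn⟩ := hX n
  obtain ⟨k, hk, hk'⟩ := hX m
  exact ⟨k, ⟨hk, m, hm, hk'⟩, hn.trans hk'⟩

include hS in
theorem IsEnumeration.tail_eq {X : Set M} {x x' : M → M} [IsFun S x] [IsFun S x']
    (hx : IsEnumeration X x) (hx' : IsEnumeration (tail X) x') (k : M) : x' k = x (k + 1) := by
  have hmem : ∀ k, x (k + 1) ∈ tail X := fun k => ⟨hx.mem _, _, hx.mem k, hx.lt k⟩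
  refine induction_delta (S := S) (P := fun k => x' k = x (k + 1)) inferInstance ?_
    (fun k ih => ?_) k
  · refine le_antisymm (hx'.zero_le _ (hmem 0)) (hx.succ_le _ _ (hx'.mem 0).1 ?_)
    obtain ⟨y, hy, hlt⟩ := (hx'.mem 0).2
    exact (hx.zero_le y hy).trans_lt hlt
  · refine le_antisymm (hx'.succ_le _ _ (hmem _) ?_) (hx.succ_le _ _ (hx'.mem _).1 ?_)
    · rw [ih]
      exact hx.lt _
    · rw [← ih]
      exact hx'.lt _

/-! ### Arrays on barriers -/

theorem InitSeg.subset_or_subset {s t X : Set M} (hs : InitSeg s X) (ht : InitSeg t X) :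
    s ⊆ t ∨ t ⊆ s := by
  by_contra! h
  obtain ⟨⟨a, ha, hat⟩, b, hb, hbs⟩ := Set.not_subset.1 h.1, Set.not_subset.1 h.2
  rcases lt_trichotomy a b with h | rfl | h
  · exact hat (ht.2 b hb a (hs.1 ha) h)
  · exact hat hb
  · exact hbs (hs.2 a ha b (ht.1 hb) h)

theorem IsBarrier.initSeg_unique {B X : Set M} (hB : IsBarrier S B) {s t : M} (hs : s ∈ B)
    (ht : t ∈ B) (hsX : InitSeg (finSet s) X) (htX : InitSeg (finSet t) X) : s = t := by
  rcases hsX.subset_or_subset htX with h | h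
  · exact hB.antichain s hs t ht h
  · exact (hB.antichain t ht s hs h).symm

/-- The image under `e` of the elements of `X` that are not less than `a`. -/
def imageFrom (e : M → M) (X : Set M) (a : M) : Set M := {z | ∃ y ∈ X, a ≤ y ∧ e y = z}

theorem imageFrom_iff {e : M → M} (he : ∀ n, n ≤ e n) {X : Set M} {a z : M} :
    z ∈ imageFrom e X a ↔ ∃ y < z + 1, y ∈ X ∧ a ≤ y ∧ e y = z :=
  ⟨fun ⟨y, hy, ha, h⟩ => ⟨y, lt_add_one_iff'.2 (h ▸ he y), hy, ha, h⟩,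
    fun ⟨y, _, hy, ha, h⟩ => ⟨y, hy, ha, h⟩⟩

theorem imageFrom_mem {e : M → M} [IsFun S e] (he : ∀ n, n ≤ e n) {X : Set M} (hX : X ∈ S) (a : M) :
    imageFrom e X a ∈ S := by
  have : Fact (X ∈ S) := ⟨hX⟩
  have := setOf_mem_delta (S := S) (P := fun z => ∃ y < z + 1, y ∈ X ∧ a ≤ y ∧ e y = z)
    inferInstance
  convert this using 1
  ext z
  exact imageFrom_iff he

theorem unbounded_imageFrom {e : M → M} (he : ∀ n, n ≤ e n) {X : Set M} (hX : Unbounded X) (a : M) :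
    Unbounded (imageFrom e X a) := fun n => by
  obtain ⟨m, hm, h⟩ := hX (max n a)
  exact ⟨e m, ⟨m, hm, ((le_max_right n a).trans_lt h).le, rfl⟩,
    ((le_max_left n a).trans_lt h).trans_le (he m)⟩

theorem tail_imageFrom {e : M → M} (he : StrictMono e) {X : Set M} {x : M → M}
    (hx : IsEnumeration X x) (k : M) :
    tail (imageFrom e X (x k)) = imageFrom e X (x (k + 1)) := by
  ext z
  constructor
  · rintro ⟨⟨y, hy, hky, rfl⟩, -, ⟨y', hy', hky', rfl⟩, hlt⟩
    exact ⟨y, hy, hx.succ_le k y hy (hky'.trans_lt (he.lt_iff_lt.1 hlt)), rfl⟩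
  · rintro ⟨y, hy, hky, rfl⟩
    have hlt := (hx.lt k).trans_le hky
    exact ⟨⟨y, hy, hlt.le, rfl⟩, _, ⟨x k, hx.mem k, le_rfl, rfl⟩, he hlt⟩

theorem imageFrom_tail (e : M → M) {X : Set M} {x : M → M} (hx : IsEnumeration X x) (k : M) :
    imageFrom e (tail X) (x (k + 1)) = imageFrom e X (x (k + 1)) := by
  ext z
  constructor
  · rintro ⟨y, hy, h⟩
    exact ⟨y, hy.1, h⟩
  · rintro ⟨y, hy, hky, rfl⟩
    exact ⟨y, ⟨hy, x k, hx.mem k, (hx.lt k).trans_le hky⟩, hky, rfl⟩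

/-- All quantifiers can be bounded because `y ≤ e y`. The set variable is read at the extended
contexts, which have the same one. -/
instance isDelta_initSeg_imageFrom {Γ : Type*} [Ctx S Γ] (e : M → M) [IsFun S e]
    [he : Fact (∀ n, n ≤ e n)] (f g : Γ → M) [IsRec S f] [IsRec S g] :
    IsDelta S (fun γ => InitSeg (finSet (f γ)) (imageFrom e (Ctx.param S γ) (g γ))) := by
  refine IsDelta.congr (P := fun γ => (∀ z ∈ finSet (f γ), ∃ y < z + 1,
      y ∈ Ctx.param S ((γ, z), y) ∧ g γ ≤ y ∧ e y = z) ∧ ∀ z ∈ finSet (f γ), ∀ w < z,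
      (∃ y < w + 1, y ∈ Ctx.param S (((γ, z), w), y) ∧ g γ ≤ y ∧ e y = w) → w ∈ finSet (f γ))
    inferInstance fun γ => and_congr (forall₂_congr fun z _ => imageFrom_iff he.out) ?_
  refine forall₂_congr fun z _ => ⟨fun h w hw hw' => h w ((imageFrom_iff he.out).2 hw') hw,
    fun h w hw' hw => h w hw ((imageFrom_iff he.out).1 hw')⟩

/-- An array on a barrier `B` induces a function on infinite sets. We consider its values at an
infinite set `X` and at the sets that result from `X` when we omit its first `k` elements. -/
theorem exists_values_of_array {B f T L : Set M} (hB : IsBarrier S B) (hf : IsFunction S f B T)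
    (hbad : ∀ s ∈ B, ∀ t ∈ B, Tri S s t → ∀ p q, pair s p ∈ f → pair t q ∈ f → pair p q ∉ L) :
    ∃ F : Inf S → M → M, IsRec S (fun p : Inf S × M => F p.1 p.2) ∧
      (∀ X k, F X k ∈ T) ∧ (∀ X k, pair (F X k) (F X (k + 1)) ∉ L) ∧
      ∀ X X' : Inf S, X'.1 = tail X.1 → ∀ k, F X' k = F X (k + 1) := by
  obtain ⟨e, hefun, hemono, hebase, hele⟩ := exists_enumeration_base hB.mem_sets hB.base_infinite
  obtain ⟨x, hx, hxe⟩ := exists_isEnumeration S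
  have : Fact (B ∈ S) := ⟨hB.mem_sets⟩
  have : Fact (f ∈ S) := ⟨hf.mem_sets⟩
  have : Fact (∀ n, n ≤ e n) := ⟨hele⟩
  have hxfun : ∀ X, IsFun S (x X) := fun X => IsRec.isFun hx X
  -- A barrier only meets infinite subsets of its base, so `X` without its first `k` elements is
  -- transported there by `e`.
  let Y : Inf S → M → Set M := fun X k => imageFrom e X.1 (x X k)
  have hYS : ∀ X k, Y X k ∈ S := fun X k => imageFrom_mem hele X.2.1 _
  have hYU : ∀ X k, Unbounded (Y X k) := fun X k => unbounded_imageFrom hele X.2.2 _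
  have hD : IsDelta S (fun p : ((Inf S × M) × M) × M =>
      p.2 ∈ B ∧ InitSeg (finSet p.2) (Y p.1.1.1 p.1.1.2) ∧ pair p.2 p.1.2 ∈ f) := by
    have : IsRec S (fun p : ((Inf S × M) × M) × M => x p.1.1.1 p.1.1.2) :=
      hx.comp isRen_fst.weak
    have : IsDelta S (fun p : ((Inf S × M) × M) × M => InitSeg (finSet p.2) (Y p.1.1.1 p.1.1.2)) :=
      isDelta_initSeg_imageFrom (S := S) e (fun p : ((Inf S × M) × M) × M => p.2)
        (fun p : ((Inf S × M) × M) × M => x p.1.1.1 p.1.1.2)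
    infer_instance
  obtain ⟨F, hF, hF'⟩ := IsSigma.exists_isRec (S := S) (Γ := Inf S × M)
    (P := fun p y => ∃ s, s ∈ B ∧ InitSeg (finSet s) (Y p.1 p.2) ∧ pair s y ∈ f)
    (IsSigma.ex (P := fun p : ((Inf S × M) × M) × M =>
      p.2 ∈ B ∧ InitSeg (finSet p.2) (Y p.1.1.1 p.1.1.2) ∧ pair p.2 p.1.2 ∈ f) hD.pos) fun p => by
      obtain ⟨s, hs, hs'⟩ := hB.exists_initSeg (Y p.1 p.2) (hYS _ _) (hYU _ _) (by
        rintro _ ⟨y, -, -, rfl⟩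
        exact hebase y)
      obtain ⟨y, hy, hy'⟩ := hf.existsUnique s hs
      refine ⟨y, ⟨s, hs, hs', hy⟩, fun z ⟨t, ht, ht', hz⟩ => hy' z ?_⟩
      rwa [hB.initSeg_unique hs ht hs' ht']
  refine ⟨fun X k => F (X, k), hF, fun X k => ?_, fun X k => ?_, fun X X' hXX' k => ?_⟩
  · obtain ⟨s, -, -, h⟩ := hF' (X, k)
    obtain ⟨s', -, q, hq, h'⟩ := hf.subset _ h
    exact Set.mem_of_eq_of_mem (pair_inj.1 h').2 hq
  · obtain ⟨s, hs, hs', h⟩ := hF' (X, k)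
    obtain ⟨t, ht, ht', h'⟩ := hF' (X, k + 1)
    -- The set `Y X k` witnesses `s ◁ t`, since its tail is `Y X (k + 1)`.
    refine hbad s hs t ht ⟨Y X k, hYS X k, hYU X k, hs', ?_⟩ _ _ h h'
    rwa [tail_imageFrom hemono (hxe X)]
  · have hY : Y X' k = Y X (k + 1) := by
      have := hxe X'
      simp only [hXX'] at this
      simp only [Y, hXX', IsEnumeration.tail_eq (S := S) (hxe X) this k]
      exact imageFrom_tail e (hxe X) k
    obtain ⟨s, hs, hs', h⟩ := hF' (X', k)
    obtain ⟨t, ht, ht', h'⟩ := hF' (X, k + 1)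
    simp only [hY] at hs'
    obtain rfl := hB.initSeg_unique hs ht hs' ht'
    exact (hf.existsUnique s hs).unique h h'

end Arrays

section Main

variable {M : Type*} [CommSemiring M] [LinearOrder M] [IsStrictOrderedRing M]
  [CanonicallyOrderedAdd M] [IsDiscrete M] {S : Set (Set M)} [hS : Fact (IsModelRCA0 S)]
  {Γ : Type*} [Ctx S Γ] {Q R T L : Set M}

/-! ### Reducing a bad array of trees to a bad array of labels -/

/-- If the label of `u` is below the label of `v`, replace `u` by its first immediate subtree that
is not below `v`. -/
noncomputable def treeStep (R L : Set M) (u v : M) : M :=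
  open Classical in if pair (fst u) (fst v) ∈ R then
    bmin u (fun a => IsEntry a (snd u) ∧ pair a v ∉ L) else u

instance isRec_treeStep [Fact (R ∈ S)] [Fact (L ∈ S)] (f g : Γ → M) [IsRec S f] [IsRec S g] :
    IsRec S (fun γ => treeStep R L (f γ) (g γ)) :=
  isRec_ite (fun γ => pair (fst (f γ)) (fst (g γ)) ∈ R)
    (fun γ => bmin (f γ) (fun a => IsEntry a (snd (f γ)) ∧ ¬ pair a (g γ) ∈ L)) f

/-- If the labels are comparable and all immediate subtrees of `u` were below `v`, then `u` would be
below `v`; so the search succeeds. -/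
theorem treeStep_cases (hLS : L ∈ S) (hT : IsTreeSet Q T) (hL : IsWeakOrder R T L) {u v : M}
    (hu : u ∈ T) (hv : v ∈ T) (huv : pair u v ∉ L) :
    treeStep R L u v = u ∧ pair (fst u) (fst v) ∉ R ∨ treeStep R L u v < u ∧
      IsEntry (treeStep R L u v) (snd u) ∧ pair (treeStep R L u v) v ∉ L := by
  have : Fact (L ∈ S) := ⟨hLS⟩
  by_cases h : pair (fst u) (fst v) ∈ R
  · right
    rw [treeStep, if_pos h]
    obtain ⟨p, hp, s, rfl, hs⟩ := hT.exists_pair hu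
    obtain ⟨q, hq, t, rfl, -⟩ := hT.exists_pair hv
    simp only [fst_pair, snd_pair] at h ⊢
    obtain ⟨a, ha, ha'⟩ : ∃ a, IsEntry a s ∧ pair a (pair q t) ∉ L := by
      by_contra! h'
      exact huv ((hL.2 p s q t hu hv).2 (Or.inl ⟨h, h'⟩))
    exact bmin_spec_delta (S := S) (P := fun a => IsEntry a s ∧ ¬ pair a (pair q t) ∈ L)
      inferInstance ⟨ha, ha'⟩ (hs a ha).2
  · exact Or.inl ⟨by rw [treeStep, if_neg h], h⟩

theorem treeStep_spec (hLS : L ∈ S) (hT : IsTreeSet Q T) (hL : IsWeakOrder R T L) {u v : M}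
    (hu : u ∈ T) (hv : v ∈ T) (huv : pair u v ∉ L) :
    treeStep R L u v ∈ T ∧ pair (treeStep R L u v) v ∉ L := by
  rcases treeStep_cases hLS hT hL hu hv huv with ⟨h, -⟩ | ⟨-, h, h'⟩
  · rw [h]
    exact ⟨hu, huv⟩
  · obtain ⟨p, -, s, rfl, hs⟩ := hT.exists_pair hu
    rw [snd_pair] at h
    exact ⟨(hs _ h).1, h'⟩

/-- The step leaves `v` alone or moves it to an immediate subtree, and whatever is below such a
subtree is below `v`. -/
theorem not_mem_treeStep (hLS : L ∈ S) (hT : IsTreeSet Q T) (hL : IsWeakOrder R T L) {u v w : M}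
    (hu : u ∈ T) (hv : v ∈ T) (hw : w ∈ T) (huv : pair u v ∉ L) (hvw : pair v w ∉ L) :
    pair u (treeStep R L v w) ∉ L := fun h2 => by
  rcases treeStep_cases hLS hT hL hv hw hvw with ⟨h, -⟩ | ⟨-, h, -⟩
  · rw [h] at h2
    exact huv h2
  · obtain ⟨p, -, s, rfl, -⟩ := hT.exists_pair hu
    obtain ⟨q, -, t, rfl, -⟩ := hT.exists_pair hv
    rw [snd_pair] at h
    exact huv (hL.of_entry hu hv h h2)

/-! ### Iteration of the reduction step -/

/-- The predecessor of a positive number. -/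
noncomputable def pred (n : M) : M := bmin n (fun m => m + 1 = n)

theorem pred_add_one (n : M) : pred (n + 1) = n :=
  bmin_eq_of_unique rfl (lt_add_one n) fun _ h => add_right_cancel h

instance isRec_pred (f : Γ → M) [IsRec S f] : IsRec S (fun γ => pred (f γ)) :=
  isRec_bmin f (fun γ m => m + 1 = f γ)

/-- The value at `i` of the finite function with code `c`. -/
noncomputable def lookup (c i : M) : M := bmin c (fun y => pair i y ∈ finSet c)

theorem lookup_eq {c i y : M} (h : ∀ z, pair i z ∈ finSet c ↔ z = y) : lookup c i = y :=
  bmin_eq_of_unique ((h y).2 rfl) (IsEntry.lt ⟨i, (h y).2 rfl⟩) fun z hz => (h z).1 hz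

instance isRec_lookup (f g : Γ → M) [IsRec S f] [IsRec S g] :
    IsRec S (fun γ => lookup (f γ) (g γ)) :=
  isRec_bmin f (fun γ y => pair (g γ) y ∈ finSet (f γ))

/-- Iterating `treeStep` along a sequence of trees. -/
structure IsIteration (R L : Set M) (F f : M → M) : Prop where
  zero : ∀ k, f (pair 0 k) = F k
  succ : ∀ n k, f (pair (n + 1) k) = treeStep R L (f (pair n k)) (f (pair n (k + 1)))

/-- Stage `n + 1` at place `k` consults place `k + 1` at stage `n`; this inequality lets the
iteration be a course-of-values recursion on codes of pairs. -/
theorem pair_succ_right_lt (n k : M) : pair n (k + 1) < pair (n + 1) k :=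
  pair_lt_pair_of_fst (by ring) (lt_add_one n)

theorem exists_isIteration [Fact (R ∈ S)] [Fact (L ∈ S)] {F : Γ → M → M}
    (hF : IsRec S (fun p : Γ × M => F p.1 p.2)) : ∃ f : Γ → M → M,
      IsRec S (fun p : Γ × M => f p.1 p.2) ∧ ∀ γ, IsIteration R L (F γ) (f γ) := by
  classical
  have : IsRec S (fun p : (Γ × M) × M => F p.1.1 (snd p.1.2)) := by
    have : IsRec S (fun p : ((Γ × M) × M) × M => F p.1.1.1 p.2) := hF.comp isRen_fst.weak.lift
    exact this.subst (fun p => snd p.1.2)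
  have : IsRec S (fun p : (Γ × M) × M => if fst p.1.2 = 0 then F p.1.1 (snd p.1.2) else
      treeStep R L (lookup p.2 (pair (pred (fst p.1.2)) (snd p.1.2)))
        (lookup p.2 (pair (pred (fst p.1.2)) (snd p.1.2 + 1)))) := by
    convert isRec_ite (S := S) (fun p : (Γ × M) × M => fst p.1.2 = 0)
      (fun p : (Γ × M) × M => F p.1.1 (snd p.1.2)) (fun p : (Γ × M) × M =>
      treeStep R L (lookup p.2 (pair (pred (fst p.1.2)) (snd p.1.2)))
        (lookup p.2 (pair (pred (fst p.1.2)) (snd p.1.2 + 1))))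
  obtain ⟨f, hf, hf'⟩ := exists_courseOfValues (S := S) (Γ := Γ)
    (fun γ z c => if fst z = 0 then F γ (snd z) else
      treeStep R L (lookup c (pair (pred (fst z)) (snd z)))
        (lookup c (pair (pred (fst z)) (snd z + 1))))
  refine ⟨f, hf, fun γ => ⟨fun k => ?_, fun n k => ?_⟩⟩
  · obtain ⟨c, -, h⟩ := hf' γ (pair 0 k)
    rw [h, fst_pair, snd_pair, if_pos rfl]
  · obtain ⟨c, hc, h⟩ := hf' γ (pair (n + 1) k)
    have hl : ∀ z < pair (n + 1) k, lookup c z = f γ z := fun z hz =>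
      lookup_eq fun y => (hc z y).trans (and_iff_right hz)
    rw [h, fst_pair, snd_pair, if_neg (hS.out.succ_ne_zero n), pred_add_one,
      hl _ (pair_lt_pair_left _ (lt_add_one n)), hl _ (pair_succ_right_lt n k)]

include hS in
variable (S) in
-- Induction follows the code of the pair, as the recursion does, so no unbounded quantifier over
-- `k` is needed.
theorem pair_induction {P : M → M → Prop}
    (hP : IsDelta S (fun p : ((Base S × M) × M) × M => P p.1.2 p.2))
    (h : ∀ n k, (∀ n' k', pair n' k' < pair n k → P n' k') → P n k) (n k : M) : P n k := by
  have key : ∀ z, ∀ n < z + 1, ∀ k < z + 1, pair n k = z → P n k := by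
    refine strong_induction_delta (S := S) inferInstance fun z ih n _ k _ hz => ?_
    refine h n k fun n' k' h' => ?_
    exact ih _ (hz ▸ h') n' (lt_add_one_iff'.2 (left_le_pair _ _)) k'
      (lt_add_one_iff'.2 (right_le_pair _ _)) rfl
  exact key _ n (lt_add_one_iff'.2 (left_le_pair _ _)) k (lt_add_one_iff'.2 (right_le_pair _ _)) rfl

theorem IsIteration.invariant (hTS : T ∈ S) (hLS : L ∈ S) (hT : IsTreeSet Q T)
    (hL : IsWeakOrder R T L) {F f : M → M} [IsFun S f] (hf : IsIteration R L F f)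
    (hFT : ∀ k, F k ∈ T) (hFL : ∀ k, pair (F k) (F (k + 1)) ∉ L) (n k : M) :
    (f (pair n k) ∈ T ∧ f (pair n (k + 1)) ∈ T) ∧
      pair (f (pair n k)) (f (pair n (k + 1))) ∉ L := by
  have : Fact (T ∈ S) := ⟨hTS⟩
  have : Fact (L ∈ S) := ⟨hLS⟩
  refine pair_induction S (P := fun n k => (f (pair n k) ∈ T ∧ f (pair n (k + 1)) ∈ T) ∧
    ¬ pair (f (pair n k)) (f (pair n (k + 1))) ∈ L) inferInstance (fun n k ih => ?_) n k
  rcases hS.out.zero_or_succ n with rfl | ⟨n, rfl⟩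
  · rw [hf.zero, hf.zero]
    exact ⟨⟨hFT k, hFT (k + 1)⟩, hFL k⟩
  · obtain ⟨⟨h1, h2⟩, h3⟩ := ih n k (pair_lt_pair_left k (lt_add_one n))
    obtain ⟨⟨-, h4⟩, h5⟩ := ih n (k + 1) (pair_succ_right_lt n k)
    rw [hf.succ, hf.succ]
    -- Badness of the new pair needs two old ones: places `k`, `k + 1` for the new left tree, places
    -- `k + 1`, `k + 2` for the new right tree.
    have h6 := treeStep_spec (R := R) hLS hT hL h1 h2 h3
    exact ⟨⟨h6.1, (treeStep_spec hLS hT hL h2 h4 h5).1⟩,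
      not_mem_treeStep hLS hT hL h6.1 h2 h4 h6.2 h5⟩

include hS in
theorem IsIteration.shift {F F' f f' : M → M} [IsFun S f] [IsFun S f'] (hf : IsIteration R L F f)
    (hf' : IsIteration R L F' f') (h : ∀ k, F' k = F (k + 1)) (n k : M) :
    f' (pair n k) = f (pair n (k + 1)) := by
  refine pair_induction S (P := fun n k => f' (pair n k) = f (pair n (k + 1))) inferInstance
    (fun n k ih => ?_) n k
  rcases hS.out.zero_or_succ n with rfl | ⟨n, rfl⟩
  · rw [hf.zero, hf'.zero, h]
  · rw [hf.succ, hf'.succ, ih n k (pair_lt_pair_left k (lt_add_one n)),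
      ih n (k + 1) (pair_succ_right_lt n k)]

/-! ### Stabilization and the limit function -/

/-- The range of `h` is `Σ⁰₁`, so it has a least element, and `h` cannot leave it once it is
attained. -/
theorem exists_eventually_const {h : M → M} [IsFun S h] (hh : ∀ n, h (n + 1) ≤ h n) :
    ∃ N, ∀ n, N ≤ n → h n = h N := by
  obtain ⟨y, ⟨N, rfl⟩, hy⟩ := exists_least_sigma (S := S) (P := fun y => ∃ n, h n = y) (a := h 0)
    (IsSigma.ex (P := fun p : (Base S × M) × M => h p.2 = p.1.2) IsDelta.pos) ⟨0, rfl⟩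
  refine ⟨N, fun n hn => le_antisymm ?_ (not_lt.1 fun hlt => hy _ hlt ⟨n, rfl⟩)⟩
  obtain ⟨d, rfl⟩ := exists_add_of_le hn
  refine induction_delta (S := S) (P := fun d => h (N + d) ≤ h N) inferInstance ?_
    (fun d ih => ?_) d
  · rw [add_zero]
  · rw [← add_assoc]
    exact (hh _).trans ih

theorem IsIteration.succ_le (hTS : T ∈ S) (hLS : L ∈ S) (hT : IsTreeSet Q T)
    (hL : IsWeakOrder R T L) {F f : M → M} [IsFun S f] (hf : IsIteration R L F f)
    (hFT : ∀ k, F k ∈ T) (hFL : ∀ k, pair (F k) (F (k + 1)) ∉ L) (n k : M) :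
    f (pair (n + 1) k) ≤ f (pair n k) := by
  obtain ⟨⟨h1, h2⟩, h3⟩ := hf.invariant hTS hLS hT hL hFT hFL n k
  rw [hf.succ]
  rcases treeStep_cases hLS hT hL h1 h2 h3 with ⟨h, -⟩ | ⟨h, -⟩
  exacts [h.le, h.le]

/-- Limits of recursive sequences are defined by `Σ⁰₂` formulas. -/
theorem exists_sigmaTwoRel {f : Inf S → M → M} (hf : IsRec S (fun p : Inf S × M => f p.1 p.2)) :
    ∃ (θ : BFm) (v : ℕ → M) (A : ℕ → Set M), (∀ i, A i ∈ S) ∧ ∀ (X : Inf S) (q : M),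
      SigmaTwoRel θ v A X.1 q ↔ ∃ m, ∀ n, m ≤ n → f X n = q := by
  have : IsRec S (fun p : ((Inf S × M) × M) × M => f p.1.1.1 p.2) := hf.comp isRen_fst.weak.lift
  have h : IsDelta S (fun p : ((Inf S × M) × M) × M => p.1.2 ≤ p.2 ∧ ¬ f p.1.1.1 p.2 = p.1.1.2) :=
    inferInstance
  obtain ⟨P0, ⟨φ, v, A, hA, hφ⟩, hP0⟩ := IsSigma.ex h.pos
  -- The formula `φ` is the matrix of the `Σ⁰₁` statement that some `n ≥ m` has `f X n ≠ q`;
  -- negating it gives the `Π⁰₁` part.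
  refine ⟨φ.neg, v, A, hA, fun X q => exists_congr fun m => ?_⟩
  have h1 := (hP0 ((X, q), m)).not
  push Not at h1
  exact (forall_congr' fun n => (not_congr (hφ (((X, q), m), n))).symm).trans h1.symm

theorem IsDeltaTwoBQO.isBQO (hQ : IsDeltaTwoBQO S Q R) (hTS : T ∈ S) (hLS : L ∈ S)
    (hT : IsTreeSet Q T) (hL : IsWeakOrder R T L) : IsBQO S T L := by
  refine ⟨hL.isQuasiOrder hQ.1 hTS hLS hT, fun B f hB hf => ?_⟩
  by_contra! hbad
  have : Fact (R ∈ S) := ⟨hQ.1.rel_mem⟩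
  have : Fact (L ∈ S) := ⟨hLS⟩
  obtain ⟨F, hF, hFT, hFL, hFtail⟩ := exists_values_of_array hB hf hbad
  obtain ⟨g, hg, hgF⟩ := exists_isIteration (S := S) (R := R) (L := L) hF
  have hgfun : ∀ X, IsFun S (g X) := fun X => IsRec.isFun hg X
  have hg0 : IsRec S (fun p : Inf S × M => fst (g p.1 (pair p.2 0))) := by
    have : IsRec S (fun p : (Inf S × M) × M => g p.1.1 p.2) := hg.comp isRen_fst.lift
    have : IsRec S (fun p : Inf S × M => g p.1 (pair p.2 0)) :=
      this.subst (fun p : Inf S × M => pair p.2 0)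
    infer_instance
  obtain ⟨θ, v, A, hA, hθ⟩ := exists_sigmaTwoRel (S := S) (f := fun X n => fst (g X (pair n 0))) hg0
  have hinv := fun X => (hgF X).invariant hTS hLS hT hL (hFT X) (hFL X)
  have hstab : ∀ X, ∃ N, ∀ n, N ≤ n → g X (pair n 0) = g X (pair N 0) := fun X => by
    have : IsFun S (fun n => g X (pair n 0)) :=
      IsRec.isFun (f := fun (_ : Base S) n => g X (pair n 0)) inferInstance
        ⟨hS.out.sets_nonempty.some, hS.out.sets_nonempty.some_mem, trivial⟩
    exact exists_eventually_const (S := S) (h := fun n => g X (pair n 0)) fun n =>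
      (hgF X).succ_le hTS hLS hT hL (hFT X) (hFL X) n 0
  obtain ⟨X, hXS, hXU, p, q, hp, hq, hpq⟩ := hQ.2 θ v A hA fun X hXS hXU => by
    obtain ⟨N, hN⟩ := hstab ⟨X, hXS, hXU⟩
    simp only [hθ ⟨X, hXS, hXU⟩]
    have huniq : ∀ q, (∃ m, ∀ n, m ≤ n → fst (g ⟨X, hXS, hXU⟩ (pair n 0)) = q) →
        q = fst (g ⟨X, hXS, hXU⟩ (pair N 0)) := by
      rintro q ⟨m, hm⟩
      rw [← hm _ (le_max_left m N), hN _ (le_max_right m N)]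
    refine ⟨⟨_, ⟨N, fun n hn => congrArg fst (hN n hn)⟩, huniq⟩, fun q hq => ?_⟩
    rw [huniq q hq]
    obtain ⟨q', hq', s, e, -⟩ := hT.exists_pair (hinv ⟨X, hXS, hXU⟩ N 0).1.1
    rwa [e, fst_pair]
  obtain ⟨N, hN⟩ := hstab ⟨X, hXS, hXU⟩
  obtain ⟨m, hm⟩ := (hθ ⟨X, hXS, hXU⟩ p).1 hp
  obtain ⟨m', hm'⟩ := (hθ ⟨tail X, tail_mem hXS, hXU.tail⟩ q).1 hq
  -- At stage `n` the tree at place `0` no longer changes, and the labels for `X` and `X⁻` have both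
  -- reached their limits `p` and `q`.
  let n := max N (max m m')
  have hnN : N ≤ n := le_max_left _ _
  have hu := hm n ((le_max_left m m').trans (le_max_right N _))
  have hv := hm' n ((le_max_right m m').trans (le_max_right N _))
  have hshift := (hgF ⟨X, hXS, hXU⟩).shift (S := S) (hgF ⟨tail X, tail_mem hXS, hXU.tail⟩)
    (hFtail ⟨X, hXS, hXU⟩ _ rfl) n 0
  simp only [hshift] at hv
  obtain ⟨⟨h1, h2⟩, h3⟩ := hinv ⟨X, hXS, hXU⟩ n 0
  have hconst := (hN (n + 1) (hnN.trans (lt_add_one n).le)).trans (hN n hnN).symm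
  rw [(hgF _).succ] at hconst
  -- An unchanged tree contradicts `p ≤ q`, and a smaller one contradicts stability.
  rcases treeStep_cases hLS hT hL h1 h2 h3 with ⟨-, h⟩ | ⟨h, -⟩
  · rw [hu, hv] at h
    exact h hpq
  · exact h.ne hconst

end Main

end SOA

theorem mainTheorem5 {M : Type*} [Zero M] [One M] [Add M] [Mul M] [LT M]
    (S : Set (Set M)) (hS : SOA.IsModelRCA0 S)
    (Q R : Set M) (hQ : SOA.IsDeltaTwoBQO S Q R) :
    (∃ T ∈ S, ∃ L ∈ S, SOA.IsTreeSet Q T ∧ SOA.IsWeakOrder R T L) ∧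
      ∀ T ∈ S, ∀ L ∈ S, SOA.IsTreeSet Q T → SOA.IsWeakOrder R T L → SOA.IsBQO S T L := by
  let := hS.commSemiring
  let := hS.linearOrder
  -- The hypothesis is restated for the operations and order of the derived instances, which unfold
  -- to the given ones.
  have hS' : SOA.IsModelRCA0 S := hS
  have := hS'.isStrictOrderedRing
  have := hS'.canonicallyOrderedAdd
  have := hS'.isDiscrete
  have : Fact (SOA.IsModelRCA0 S) := ⟨hS'⟩
  constructor
  · obtain ⟨T, hT, hT'⟩ := SOA.exists_isTreeSet (S := S) hQ.1.field_mem
    obtain ⟨L, hL, hL'⟩ := SOA.exists_isWeakOrder (S := S) hQ.1.rel_mem hT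
    exact ⟨T, hT, L, hL, hT', hL'⟩
  · intro T hT L hL hT' hL'
    exact SOA.IsDeltaTwoBQO.isBQO (S := S) hQ hT hL hT' hL'
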